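/- **Lemma (Lusternik–Schnirelman inequality).** Let $W\in C^3(\mathbb R)$ be an even nonnegative double-well potential: its critical points are exactly $-1,0,1$, with $W(\pm1)=0$, $W''(\pm1)>0$ and a local maximum at $0$. Put $2\sigma=\int_{-1}^1\sqrt{2W(t)}\,dt$. For an open set $\Omega\subset\mathbb R^{n+1}$ of finite volume $|\Omega|$, $\varepsilon>0$ and $u\in H^1(\Omega)$ let $$E_\varepsilon(u,\Omega)=\int_\Omega \frac{\varepsilon|\nabla u|^2}{2}+\frac{W(u)}{\varepsilon}\in[0,\infty].$$ For a compact symmetric set $A\subset H^1(\Omega)$ let $\mathrm{ind}(A)$ be its cohomological $\mathbb Z/2$-index: $\mathrm{ind}(A)=+\infty$ if $0\in A$; otherwise $\mathrm{ind}(A)$ is the supremum ($0$ if there is none) of the integers $k\ge1$ with $\tilde f^*(w^{k-1})\ne0$ in the Alexander–Spanier cohomology $H^{k-1}(A/\{x\sim-x\};\mathbb Z/2)$, where $\tilde f:A/\{x\sim-x\}\to\mathbb{RP}^\infty$ is induced by an odd continuous map $f:A\to S^\infty$ and $w$ is the generator of $H^1(\mathbb{RP}^\infty;\mathbb Z/2)$.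 For integers $p\ge0$ define $$c_\varepsilon(p,\Omega)=\inf_{A}\ \sup_{u\in A}E_\varepsilon(u,\Omega),\qquad \ell_p(\Omega)=\frac1{2\sigma}\liminf_{\varepsilon\to0^+}c_\varepsilon(p,\Omega),$$ the infimum being over all compact symmetric $A\subset H^1(\Omega)$ with $\mathrm{ind}(A)\ge p+1$, and $$\gamma(\Omega)=\inf\Big\{\gamma>0:\ p^{-\frac1{n+1}}\limsup_{\varepsilon\to0^+}c_\varepsilon(p,\Omega)\le\gamma\ \text{ for all integers } p\ge1\Big\}$$ (all these quantities are elements of $[0,\infty]$). Let $N\ge1$ and let $\Omega$ and $\Omega_1,\dots,\Omega_N$ be open subsets of $\mathbb R^{n+1}$ (for example bounded domains with piecewise smooth boundary) with $|\Omega|=|\Omega_i|=1$. Let $\Omega_1^*,\dots,\Omega_N^*$ be pairwise disjoint subsets of $\Omega$ such that each $\Omega_i^*$ is similar to $\Omega_i$, i.e. is its image under a composition of a scaling and an isometry. Then for every integer $p\ge1$ $$p^{-\frac1{n+1}}\ell_p(\Omega)\ \ge\ \sum_{i=1}^N|\Omega_i^*|\,p_i^{-\frac1{n+1}}\ell_{p_i}(\Omega_i)-\frac{c}{pV},$$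 where $p_i=\lfloor p|\Omega_i^*|\rfloor$, $V=\min_i|\Omega_i^*|$ and $c=\frac1{2\sigma}\max_i\gamma(\Omega_i)$. Terms with $p_i=0$ are read as $0$, and the inequality is understood with $\frac{c}{pV}$ added to the left-hand side, so that it makes sense also if some of the quantities are infinite. -/

import Mathlib

open MeasureTheory Filter Topology
open scoped ENNReal

noncomputable section

namespace PhaseTransition

/-! ### Alexander-Spanier cohomology with coefficients in `ZMod 2`

A `q`-cochain is a function on `(q+1)`-tuples of points, two cochains being identified when their
difference is locally zero, that is, vanishes on all tuples contained in one member of some open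
cover. A class is given by a representing cochain, and it is zero iff that cochain is a
coboundary in the sense of `IsCoboundary`. -/

/-- `(q+1)`-ary functions on `X` with values in `ZMod 2`. -/
abbrev Cochain (X : Type*) (q : ℕ) : Type _ := (Fin (q + 1) → X) → ZMod 2

/-- The cochain vanishes on all tuples lying in one member of some open cover. -/
def LocallyZero {X : Type*} [TopologicalSpace X] {q : ℕ} (φ : Cochain X q) : Prop :=
  ∀ x : X, ∃ U ∈ 𝓝 x, ∀ v : Fin (q + 1) → X, (∀ i, v i ∈ U) → φ v = 0

/-- The coboundary operator (signs do not matter modulo `2`). -/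
def coboundary {X : Type*} {q : ℕ} (φ : Cochain X q) : Cochain X (q + 1) :=
  fun v => ∑ i : Fin (q + 2), φ (fun j => v (i.succAbove j))

/-- `φ` represents a cocycle of the complex of cochains modulo locally zero cochains. -/
def IsCocycle {X : Type*} [TopologicalSpace X] {q : ℕ} (φ : Cochain X q) : Prop :=
  LocallyZero (coboundary φ)

/-- `φ` represents zero in the `q`-th cohomology: it is a coboundary modulo locally zero
cochains (in degree zero: it is locally zero). -/
def IsCoboundary {X : Type*} [TopologicalSpace X] : {q : ℕ} → Cochain X q → Prop
  | 0, φ => LocallyZero φ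
  | q + 1, φ => ∃ ψ : Cochain X q, LocallyZero (φ - coboundary ψ)

/-- The cup product: front face times back face. -/
def cup {X : Type*} {p q : ℕ} (φ : Cochain X p) (ψ : Cochain X q) : Cochain X (p + q) :=
  fun v => φ (fun i => v ⟨i, by omega⟩) * ψ (fun i => v ⟨p + i, by omega⟩)

/-- The `m`-th cup power of a `1`-cochain; the `0`-th power is the constant `1`. -/
def cupPow {X : Type*} (ω : Cochain X 1) : (m : ℕ) → Cochain X m
  | 0 => fun _ => 1
  | m + 1 => cup (cupPow ω m) ω

/-- Pull-back of cochains along a map. -/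
def pullback {X Y : Type*} {q : ℕ} (f : X → Y) (φ : Cochain Y q) : Cochain X q :=
  fun v => φ (fun i => f (v i))

/-! ### The infinite sphere and the infinite projective space -/

/-- The unit sphere `S^∞`, the union of the finite dimensional unit spheres. -/
def SphereInf : Type := {x : ℕ →₀ ℝ // (x.sum fun _ t => t ^ 2) = 1}

/-- The finite dimensional sphere `S^k` inside `S^∞`. -/
def SphereStage (k : ℕ) : Type := {x : SphereInf // ∀ i, k < i → x.1 i = 0}

/-- The usual (coordinatewise) topology of `S^k`. -/
instance (k : ℕ) : TopologicalSpace (SphereStage k) :=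
  TopologicalSpace.induced (fun (x : SphereStage k) (i : ℕ) => x.1.1 i) inferInstance

/-- `S^∞` carries the direct limit topology: a set is open iff its trace on each `S^k` is. -/
instance : TopologicalSpace SphereInf :=
  ⨆ k : ℕ, TopologicalSpace.coinduced (fun x : SphereStage k => x.1) inferInstance

/-- The relation `x = ± y` on a type mapped into an additive group by `ι`. -/
def antipodal {X F : Type*} [AddCommGroup F] (ι : X → F) : Setoid X where
  r x y := ι x = ι y ∨ ι x = -ι y
  iseqv :=
    { refl := fun _ => Or.inl rfl
      symm := by
        rintro x y (h | h)
        · exact Or.inl h.symm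
        · exact Or.inr (by rw [h, neg_neg])
      trans := by
        rintro x y z (h | h) (h' | h')
        · exact Or.inl (h.trans h')
        · exact Or.inr (h.trans h')
        · exact Or.inr (by rw [h, h'])
        · exact Or.inl (by rw [h, h', neg_neg]) }

/-- `ℝP^∞`, with the quotient topology. -/
abbrev RPInf : Type := Quotient (antipodal fun x : SphereInf => x.1)

/-- The orbit space `A / {x ∼ -x}`, with the quotient topology. -/
abbrev OrbitSpace {E : Type*} [AddCommGroup E] (A : Set E) : Type _ :=
  Quotient (antipodal fun x : A => (x : E))

/-- Odd continuous maps from `A` to `S^∞`. -/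
structure OddMap {E : Type*} [AddCommGroup E] [TopologicalSpace E] (A : Set E) where
  toFun : A → SphereInf
  continuous_toFun : Continuous toFun
  odd : ∀ x y : A, (y : E) = -(x : E) → (toFun y).1 = -(toFun x).1

/-- The map of orbit spaces induced by an odd map. -/
def OddMap.descend {E : Type*} [AddCommGroup E] [TopologicalSpace E] {A : Set E}
    (f : OddMap A) : OrbitSpace A → RPInf :=
  Quotient.map f.toFun (by
    rintro x y (h | h)
    · exact Or.inl (by rw [Subtype.ext h])
    · exact Or.inr (f.odd y x h))

open Classical in
/-- The cohomological `ℤ/2`-index of a symmetric set: `∞` if the set contains the origin, and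
otherwise the supremum of the `k ≥ 1` such that the pull-back of `w ^ (k - 1)` to the orbit space
is nonzero. Here `w`, represented by `ω`, is the nonzero class in `H¹(ℝP^∞; ℤ/2)`, and the
pull-back is by the map induced by an odd continuous map to `S^∞`. -/
def ind {E : Type*} [AddCommGroup E] [TopologicalSpace E] (A : Set E) : ℕ∞ :=
  if (0 : E) ∈ A then ⊤
  else sSup {k : ℕ∞ | ∃ m : ℕ, k = ((m + 1 : ℕ) : ℕ∞) ∧
    ∃ ω : Cochain RPInf 1, IsCocycle ω ∧ ¬ IsCoboundary ω ∧
      ∃ f : OddMap A, ¬ IsCoboundary (pullback f.descend (cupPow ω m))}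

/-! ### The Sobolev space `H¹` -/

/-- The Euclidean space `ℝ^(n+1)`. -/
abbrev Euc (n : ℕ) : Type := EuclideanSpace ℝ (Fin (n + 1))

/-- Smooth real functions with compact support inside `Ω`. -/
def IsTest {n : ℕ} (Ω : Set (Euc n)) (φ : Euc n → ℝ) : Prop :=
  ContDiff ℝ ((⊤ : ℕ∞) : WithTop ℕ∞) φ ∧ HasCompactSupport φ ∧ tsupport φ ⊆ Ω

/-- `g` is the weak gradient of `u` in `Ω`. -/
def IsWeakGradient {n : ℕ} (Ω : Set (Euc n)) (u : Euc n → ℝ) (g : Euc n → Euc n) : Prop :=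
  ∀ φ : Euc n → ℝ, IsTest Ω φ → ∀ v : Euc n,
    ∫ x in Ω, u x * fderiv ℝ φ x v = -∫ x in Ω, inner ℝ (g x) v * φ x

theorem IsTest.integrable_mul_fderiv {n : ℕ} {Ω : Set (Euc n)} {φ : Euc n → ℝ}
    (h : IsTest Ω φ) (v : Euc n) {u : Euc n → ℝ} (hu : MemLp u 2 (volume.restrict Ω)) :
    Integrable (fun x => u x * fderiv ℝ φ x v) (volume.restrict Ω) := by
  have hc : Continuous fun x => fderiv ℝ φ x v :=
    (h.1.continuous_fderiv (by simp)).clm_apply continuous_const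
  have hs : HasCompactSupport fun x => fderiv ℝ φ x v := h.2.1.fderiv_apply (𝕜 := ℝ) v
  have hm : MemLp (fun x => fderiv ℝ φ x v) 2 (volume.restrict Ω) :=
    (hc.memLp_of_hasCompactSupport hs).restrict Ω
  exact hu.integrable_mul hm

theorem IsTest.integrable_inner_mul {n : ℕ} {Ω : Set (Euc n)} {φ : Euc n → ℝ}
    (h : IsTest Ω φ) (v : Euc n) {g : Euc n → Euc n} (hg : MemLp g 2 (volume.restrict Ω)) :
    Integrable (fun x => inner ℝ (g x) v * φ x) (volume.restrict Ω) := by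
  have hm : MemLp φ 2 (volume.restrict Ω) :=
    (h.1.continuous.memLp_of_hasCompactSupport h.2.1).restrict Ω
  have hi : MemLp (fun x => inner ℝ (g x) v) 2 (volume.restrict Ω) := hg.inner_const v
  exact hi.integrable_mul hm

/-- The Sobolev space `H¹(Ω)`: pairs of `u ∈ L²(Ω)` and its weak gradient in `L²(Ω; ℝ^(n+1))`,
with the topology of `L²`-convergence of functions and gradients. -/
def H1 {n : ℕ} (Ω : Set (Euc n)) :
    Submodule ℝ (Lp ℝ 2 (volume.restrict Ω) × Lp (Euc n) 2 (volume.restrict Ω)) where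
  carrier := {w | IsWeakGradient Ω w.1 w.2}
  zero_mem' := by
    intro φ _ v
    have e1 : ∫ x in Ω, (0 : Lp ℝ 2 (volume.restrict Ω)) x * fderiv ℝ φ x v = 0 := by
      refine integral_eq_zero_of_ae ?_
      filter_upwards [Lp.coeFn_zero ℝ 2 (volume.restrict Ω)] with x hx
      rw [hx]
      simp
    have e2 : ∫ x in Ω, inner ℝ ((0 : Lp (Euc n) 2 (volume.restrict Ω)) x) v * φ x = 0 := by
      refine integral_eq_zero_of_ae ?_
      filter_upwards [Lp.coeFn_zero (Euc n) 2 (volume.restrict Ω)] with x hx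
      rw [hx]
      simp
    simp only [Prod.fst_zero, Prod.snd_zero, e1, e2, neg_zero]
  add_mem' := by
    intro a b ha hb φ hφ v
    have e1 : ∫ x in Ω, (a + b).1 x * fderiv ℝ φ x v
        = ∫ x in Ω, (a.1 x * fderiv ℝ φ x v + b.1 x * fderiv ℝ φ x v) := by
      apply integral_congr_ae
      filter_upwards [Lp.coeFn_add a.1 b.1] with x hx
      simp only [Prod.fst_add, hx, Pi.add_apply]
      ring
    have e2 : ∫ x in Ω, inner ℝ ((a + b).2 x) v * φ x
        = ∫ x in Ω, (inner ℝ (a.2 x) v * φ x + inner ℝ (b.2 x) v * φ x) := by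
      apply integral_congr_ae
      filter_upwards [Lp.coeFn_add a.2 b.2] with x hx
      simp only [Prod.snd_add, hx, Pi.add_apply, inner_add_left]
      ring
    rw [e1, e2, integral_add (hφ.integrable_mul_fderiv v (Lp.memLp a.1))
      (hφ.integrable_mul_fderiv v (Lp.memLp b.1)),
      integral_add (hφ.integrable_inner_mul v (Lp.memLp a.2))
      (hφ.integrable_inner_mul v (Lp.memLp b.2)), ha φ hφ v, hb φ hφ v]
    ring
  smul_mem' := by
    intro c a ha φ hφ v
    have e1 : ∫ x in Ω, (c • a).1 x * fderiv ℝ φ x v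
        = ∫ x in Ω, c * (a.1 x * fderiv ℝ φ x v) := by
      apply integral_congr_ae
      filter_upwards [Lp.coeFn_smul c a.1] with x hx
      simp only [Prod.smul_fst, hx, Pi.smul_apply, smul_eq_mul]
      ring
    have e2 : ∫ x in Ω, inner ℝ ((c • a).2 x) v * φ x
        = ∫ x in Ω, c * (inner ℝ (a.2 x) v * φ x) := by
      apply integral_congr_ae
      filter_upwards [Lp.coeFn_smul c a.2] with x hx
      simp only [Prod.smul_snd, hx, Pi.smul_apply, real_inner_smul_left]
      ring
    rw [e1, e2, integral_const_mul, integral_const_mul, ha φ hφ v]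
    ring

/-! ### The Allen-Cahn energy and the phase transition spectrum -/

/-- Even double-well potentials of class `C³`. -/
structure IsDoubleWell (W : ℝ → ℝ) : Prop where
  contDiff : ContDiff ℝ 3 W
  even : ∀ t, W (-t) = W t
  nonneg : ∀ t, 0 ≤ W t
  critical : ∀ t, deriv W t = 0 ↔ t = -1 ∨ t = 0 ∨ t = 1
  zero_neg_one : W (-1) = 0
  zero_one : W 1 = 0
  nondegenerate_neg_one : 0 < deriv (deriv W) (-1)
  nondegenerate_one : 0 < deriv (deriv W) 1
  isLocalMax : IsLocalMax W 0

/-- `σ = ∫_{-1}^1 √(W(t)/2) dt`. -/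
def sigma (W : ℝ → ℝ) : ℝ := ∫ t in (-1 : ℝ)..1, Real.sqrt (W t / 2)

/-- `E_ε(u) = ∫_Ω ε |∇u|² / 2 + W(u) / ε`, with values in `[0, ∞]`. -/
def energy (W : ℝ → ℝ) (ε : ℝ) {n : ℕ} (Ω : Set (Euc n)) (u : H1 Ω) : ℝ≥0∞ :=
  ∫⁻ x in Ω, ENNReal.ofReal (ε * ‖u.1.2 x‖ ^ 2 / 2 + W (u.1.1 x) / ε)

/-- The family `𝓕_p` of compact symmetric subsets of `H¹(Ω)` of index at least `p + 1`. -/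
def sweepouts (p : ℕ) {n : ℕ} (Ω : Set (Euc n)) : Set (Set (H1 Ω)) :=
  {A | IsCompact A ∧ (∀ u ∈ A, -u ∈ A) ∧ ((p + 1 : ℕ) : ℕ∞) ≤ ind A}

/-- The min-max values `c_ε(p, Ω)`. -/
def minmax (W : ℝ → ℝ) (ε : ℝ) (p : ℕ) {n : ℕ} (Ω : Set (Euc n)) : ℝ≥0∞ :=
  ⨅ A ∈ sweepouts p Ω, ⨆ u ∈ A, energy W ε Ω u

/-- The (lower) phase transition spectrum
`ℓ_p(Ω) = (2σ)⁻¹ liminf_{ε → 0⁺} c_ε(p, Ω)`. -/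
def spectrum (W : ℝ → ℝ) (p : ℕ) {n : ℕ} (Ω : Set (Euc n)) : ℝ≥0∞ :=
  liminf (fun ε : ℝ => minmax W ε p Ω) (𝓝[>] 0) / ENNReal.ofReal (2 * sigma W)

/-- The factor `p^{-1/(n+1)}`. Its value at `p = 0` is `0`. -/
def weight (n p : ℕ) : ℝ≥0∞ := ENNReal.ofReal ((p : ℝ) ^ (-(1 : ℝ) / ((n : ℝ) + 1)))

/-- `γ(Ω)`, the smallest `γ` such that `p^{-1/(n+1)} limsup_{ε → 0⁺} c_ε(p, Ω) ≤ γ` for all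
`p ≥ 1`. -/
def gammaConst (W : ℝ → ℝ) {n : ℕ} (Ω : Set (Euc n)) : ℝ≥0∞ :=
  sInf {γ : ℝ≥0∞ | 0 < γ ∧ ∀ p : ℕ, 1 ≤ p →
    weight n p * limsup (fun ε : ℝ => minmax W ε p Ω) (𝓝[>] 0) ≤ γ}

/-- `Ω₂` is the image of `Ω₁` under the composition of a scaling and an isometry. -/
def AreSimilar {n : ℕ} (Ω₁ Ω₂ : Set (Euc n)) : Prop :=
  ∃ r : ℝ, 0 < r ∧ ∃ e : Euc n ≃ᵢ Euc n, Ω₂ = (fun x => e (r • x)) '' Ω₁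

end PhaseTransition

end

/-! Fix ε and a compact symmetric set A of index at least p + 1 that avoids the origin. Restriction
to Ω_i* followed by rescaling is a continuous odd map R_i from H¹(Ω) to H¹(Ω_i), and it turns the
part of E_ε carried by Ω_i* into r_i^n E_{ε/r_i} on Ω_i, where |Ω_i*| = r_i^(n+1). Given levels d_i
below c_{ε/r_i}(p_i, Ω_i), let C_i be the closed symmetric set of those u in A for which R_i u has
energy at most d_i. The image R_i(C_i) has index at most p_i, so the p_i-th power of the class of
the double cover A → A/± vanishes near C_i/±. If the C_i covered A, a cup length argument would kill
the power ∑ p_i ≤ p on all of A/±, against the index of A (`exists_le_ind_image`). Hence a single u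
in A exceeds all the levels at once. The pieces Ω_i* are disjoint, so their energies add up to at
most E_ε(u), which gives ∑ r_i^n c_{ε/r_i}(p_i, Ω_i) ≤ c_ε(p, Ω) (`sum_minmax_le`).

The lower limit is superadditive and does not see the change from ε to ε/r_i. If p_i were exactly
p|Ω_i*|, the weights on the two sides would agree. Rounding down costs at most |Ω_i*| γ/(pV) in the
i-th term (`volume_mul_weight_mul_le`), and these errors add up to at most γ/(pV) because the
volumes sum to at most 1.

The topology rests on two facts. A nonzero class in H¹(ℝP^∞; ℤ/2), lifted to S^∞, is the coboundary
of a function h with h(-x) = h(x) + 1 (`exists_odd_primitive`), so odd maps defined on different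
sets pull it back to comparable cocycles. And since cochains are arbitrary functions, of which only
the germs at points matter, vanishing of powers can be transferred along a map that is continuous
merely at the points of C_i, such as a nearest point projection (`PowVanishes.of_image`). -/

noncomputable section

namespace PhaseTransition

/-! ### Cochains on sequences

A `q`-cochain is viewed as a function of sequences that only depends on the entries `0, …, q`. -/

/-- The increasing map `ℕ → ℕ` that omits the value `i`. -/
def skip (i j : ℕ) : ℕ := if j < i then j else j + 1

/-- Functions of sequences with values in `ZMod 2`. -/
abbrev SeqCochain (X : Type*) : Type _ := (ℕ → X) → ZMod 2

/-- Coboundary of a `q`-cochain on sequences. -/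
def seqCoboundary {X : Type*} (q : ℕ) (ψ : SeqCochain X) : SeqCochain X :=
  fun v => ∑ i ∈ Finset.range (q + 2), ψ (fun j => v (skip i j))

/-- The value only depends on the entries `0, …, q`. -/
def DependsUpTo {X : Type*} (q : ℕ) (ψ : SeqCochain X) : Prop :=
  ∀ v w : ℕ → X, (∀ i ≤ q, v i = w i) → ψ v = ψ w

/-- The cup power of a `1`-cochain. -/
def seqPow {X : Type*} (ω : X → X → ZMod 2) (m : ℕ) : SeqCochain X :=
  fun v => ∏ i ∈ Finset.range m, ω (v i) (v (i + 1))

/-- The `1`-cochain `ω` satisfies the cocycle identity on `U`. -/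
def CocycleOn {X : Type*} (ω : X → X → ZMod 2) (U : Set X) : Prop :=
  ∀ a ∈ U, ∀ b ∈ U, ∀ c ∈ U, ω a b + ω b c + ω a c = 0

/-- The cochain vanishes on the sequences that stay close to a point of `C`. -/
def VanishesNear {X : Type*} [TopologicalSpace X] (C : Set X) (φ : SeqCochain X) : Prop :=
  ∀ x ∈ C, ∃ U ∈ 𝓝 x, ∀ v : ℕ → X, (∀ i, v i ∈ U) → φ v = 0

/-- The `1`-cochain `ω` is a cocycle near `C`. -/
def CocycleNear {X : Type*} [TopologicalSpace X] (C : Set X) (ω : X → X → ZMod 2) : Prop :=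
  ∀ x ∈ C, ∃ U ∈ 𝓝 x, CocycleOn ω U

/-- The `a`-th cup power of `ω` is a coboundary near `C`. -/
def PowVanishes {X : Type*} [TopologicalSpace X] (ω : X → X → ZMod 2) (C : Set X) : ℕ → Prop
  | 0 => C = ∅
  | a + 1 => ∃ ψ : SeqCochain X, DependsUpTo a ψ ∧
      VanishesNear C fun v => seqPow ω (a + 1) v + seqCoboundary a ψ v

/-! ### Leibniz rule and powers of a cocycle modulo 2. -/

section Algebra

variable {X : Type*}

theorem zmod_two_add_self (x : ZMod 2) : x + x = 0 := CharTwo.add_self_eq_zero x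

/-- Leibniz rule. Omitting the last entry of the front factor and omitting the first entry of the
back factor both give ψ v times the shifted β; this extra term occurs twice on the right and cancels
modulo 2. -/
theorem seqCoboundary_mul {a b c : ℕ} (hc : c = a + b) {ψ : SeqCochain X} (hψ : DependsUpTo a ψ)
    (β : SeqCochain X) (v : ℕ → X) :
    seqCoboundary c (fun v => ψ v * β fun j => v (a + j)) v =
      seqCoboundary a ψ v * β (fun j => v (a + 1 + j)) +
        ψ v * seqCoboundary b β (fun j => v (a + j)) := by
  subst hc
  have h1 : ∀ i ∈ Finset.range (a + 1),
      ψ (fun j => v (skip i j)) * β (fun j => v (skip i (a + j))) =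
        ψ (fun j => v (skip i j)) * β (fun j => v (a + 1 + j)) := by
    intro i hi
    rw [Finset.mem_range] at hi
    congr 2
    funext j
    simp only [skip]
    rw [if_neg (by omega)]
    congr 1
    omega
  have h2 : ∀ i ∈ Finset.range (b + 1),
      ψ (fun j => v (skip (a + 1 + i) j)) * β (fun j => v (skip (a + 1 + i) (a + j))) =
        ψ v * β (fun j => v (a + skip (i + 1) j)) := by
    intro i _
    congr 1
    · apply hψ
      intro j hj
      simp only [skip]
      rw [if_pos (by omega)]
    · congr 1
      funext j
      simp only [skip]
      split_ifs <;> first | rfl | omega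
  have h3 : ψ (fun j => v (skip (a + 1) j)) = ψ v := by
    apply hψ
    intro j hj
    simp only [skip]
    rw [if_pos (by omega)]
  have h4 : (fun j => v (a + skip 0 j)) = fun j => v (a + 1 + j) := by
    funext j
    simp only [skip]
    rw [if_neg (by omega)]
    congr 1
    omega
  simp only [seqCoboundary]
  rw [show a + b + 2 = (a + 1) + (b + 1) by ring, Finset.sum_range_add, Finset.sum_congr rfl h1,
    Finset.sum_congr rfl h2, show a + 2 = (a + 1) + 1 by ring, Finset.sum_range_succ _ (a + 1),
    h3, show b + 2 = (b + 1) + 1 by ring, Finset.sum_range_succ' _ (b + 1), h4,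
    ← Finset.sum_mul, ← Finset.mul_sum]
  linear_combination -zmod_two_add_self (ψ v * β (fun j => v (a + 1 + j)))

theorem skip_skip {i j : ℕ} (h : i ≤ j) (k : ℕ) : skip i (skip j k) = skip (j + 1) (skip i k) := by
  simp only [skip]
  split_ifs <;> omega

/-- By `skip_skip` the double faces (i, j) with i ≤ j and (j + 1, i) coincide, so the double sum
cancels in pairs modulo 2. -/
theorem seqCoboundary_seqCoboundary (q : ℕ) (ψ : SeqCochain X) (v : ℕ → X) :
    seqCoboundary (q + 1) (seqCoboundary q ψ) v = 0 := by
  simp only [seqCoboundary]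
  rw [Finset.sum_sigma']
  refine Finset.sum_involution
    (fun x _ => if x.1 ≤ x.2 then ⟨x.2 + 1, x.1⟩ else ⟨x.2, x.1 - 1⟩) ?_ ?_ ?_ ?_
  · rintro ⟨i, j⟩ _
    split_ifs with h
    · dsimp only at h
      simp only [skip_skip h]
      exact zmod_two_add_self _
    · dsimp only at h
      obtain ⟨i, rfl⟩ : ∃ k, i = k + 1 := ⟨i - 1, by omega⟩
      simp only [Nat.add_sub_cancel]
      simp only [← skip_skip (show j ≤ i by omega)]
      exact zmod_two_add_self _
  · rintro ⟨i, j⟩ _ _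
    split_ifs with h <;> simp only [ne_eq, Sigma.mk.injEq, heq_eq_eq, not_and] <;>
      dsimp only at h <;> omega
  · rintro ⟨i, j⟩ h
    simp only [Finset.mem_sigma, Finset.mem_range] at h
    split_ifs with h' <;> dsimp only at h' <;>
      simp only [Finset.mem_sigma, Finset.mem_range] <;> omega
  · rintro ⟨i, j⟩ _
    by_cases h : i ≤ j
    · simp only [h, if_true]
      rw [if_neg (by omega)]
      simp
    · simp only [h, if_false]
      rw [if_pos (by omega)]
      congr 1
      omega

theorem seqCoboundary_add (q : ℕ) (φ ψ : SeqCochain X) (v : ℕ → X) :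
    seqCoboundary q (fun v => φ v + ψ v) v = seqCoboundary q φ v + seqCoboundary q ψ v := by
  simp only [seqCoboundary, Finset.sum_add_distrib]

theorem seqPow_add (ω : X → X → ZMod 2) (a b : ℕ) (v : ℕ → X) :
    seqPow ω (a + b) v = seqPow ω a v * seqPow ω b (fun j => v (a + j)) := by
  simp only [seqPow, Finset.prod_range_add, add_assoc]

theorem seqPow_one (ω : X → X → ZMod 2) (v : ℕ → X) : seqPow ω 1 v = ω (v 0) (v 1) := by
  simp [seqPow]

theorem dependsUpTo_seqPow (ω : X → X → ZMod 2) (m : ℕ) : DependsUpTo m (seqPow ω m) := by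
  intro v w h
  refine Finset.prod_congr rfl fun i hi => ?_
  rw [Finset.mem_range] at hi
  rw [h i hi.le, h (i + 1) hi]

theorem dependsUpTo_seqCoboundary {q : ℕ} {ψ : SeqCochain X} (h : DependsUpTo q ψ) :
    DependsUpTo (q + 1) (seqCoboundary q ψ) := by
  intro v w hv
  refine Finset.sum_congr rfl fun i _ => h _ _ fun j hj => hv _ ?_
  simp only [skip]
  split_ifs <;> omega

theorem DependsUpTo.add {q : ℕ} {φ ψ : SeqCochain X} (hφ : DependsUpTo q φ)
    (hψ : DependsUpTo q ψ) : DependsUpTo q (fun v => φ v + ψ v) := by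
  intro v w h
  simp only [hφ v w h, hψ v w h]

theorem DependsUpTo.mul {a b c : ℕ} (hc : c = a + b) {φ ψ : SeqCochain X} (hφ : DependsUpTo a φ)
    (hψ : DependsUpTo b ψ) : DependsUpTo c (fun v => φ v * ψ fun j => v (a + j)) := by
  intro v w h
  simp only
  rw [hφ v w fun i hi => h i (by omega),
    hψ (fun j => v (a + j)) (fun j => w (a + j)) fun i hi => h _ (by omega)]

theorem seqCoboundary_seqPow_one {ω : X → X → ZMod 2} {U : Set X} (h : CocycleOn ω U)
    {v : ℕ → X} (hv : ∀ i, v i ∈ U) : seqCoboundary 1 (seqPow ω 1) v = 0 := by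
  have := h _ (hv 0) _ (hv 1) _ (hv 2)
  simp [seqCoboundary, seqPow, skip, Finset.sum_range_succ]
  linear_combination this

/-- Induction with the Leibniz rule, splitting off one factor ω at a time. -/
theorem seqCoboundary_seqPow {ω : X → X → ZMod 2} {U : Set X} (h : CocycleOn ω U) (m : ℕ)
    {v : ℕ → X} (hv : ∀ i, v i ∈ U) : seqCoboundary m (seqPow ω m) v = 0 := by
  induction m with
  | zero =>
    simp [seqCoboundary, seqPow]
    exact zmod_two_add_self 1
  | succ m ih =>
    have e : seqPow ω (m + 1) = fun v => seqPow ω m v * seqPow ω 1 fun j => v (m + j) :=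
      funext fun v => seqPow_add ω m 1 v
    rw [e, seqCoboundary_mul rfl (dependsUpTo_seqPow ω m), ih,
      seqCoboundary_seqPow_one h fun i => hv _]
    ring

end Algebra

/-! ### Cup length and naturality for powers that vanish near a set. -/

section Vanishing

variable {X : Type*} [TopologicalSpace X] {ω : X → X → ZMod 2}

theorem powVanishes_empty (a : ℕ) : PowVanishes ω (∅ : Set X) a := by
  cases a with
  | zero => rfl
  | succ a => exact ⟨fun _ => 0, fun _ _ _ => rfl, fun x hx => hx.elim⟩

theorem PowVanishes.succ {C : Set X} (hω : CocycleNear C ω) {a : ℕ} (h : PowVanishes ω C a) :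
    PowVanishes ω C (a + 1) := by
  cases a with
  | zero =>
    obtain rfl : C = ∅ := h
    exact powVanishes_empty _
  | succ a =>
    obtain ⟨ψ, h1, h2⟩ := h
    -- As ω is a cocycle, δ(ψ ω) = δψ · ω.
    refine ⟨fun v => ψ v * seqPow ω 1 fun j => v (a + j),
      h1.mul rfl (dependsUpTo_seqPow ω 1), fun x hx => ?_⟩
    obtain ⟨U, hU, h3⟩ := h2 x hx
    obtain ⟨V, hV, h4⟩ := hω x hx
    refine ⟨U ∩ V, inter_mem hU hV, fun v hv => ?_⟩
    beta_reduce
    rw [seqCoboundary_mul rfl h1, seqCoboundary_seqPow_one h4 fun i => (hv _).2,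
      seqPow_add ω (a + 1) 1]
    linear_combination (seqPow ω 1 fun j => v (a + 1 + j)) * h3 v fun i => (hv i).1

theorem PowVanishes.of_le {C : Set X} (hω : CocycleNear C ω) {a b : ℕ} (hab : a ≤ b)
    (h : PowVanishes ω C a) : PowVanishes ω C b := by
  induction b, hab using Nat.le_induction with
  | base => exact h
  | succ b _ ih => exact ih.succ hω

/-- Cup length: powers vanishing near two sets multiply to a power vanishing near the union. -/
theorem PowVanishes.union {C D : Set X} (hω : CocycleNear (C ∪ D) ω) {a b : ℕ}
    (hC : PowVanishes ω C a) (hD : PowVanishes ω D b) : PowVanishes ω (C ∪ D) (a + b) := by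
  cases a with
  | zero =>
    obtain rfl : C = ∅ := hC
    simpa using hD
  | succ a =>
  cases b with
  | zero =>
    obtain rfl : D = ∅ := hD
    simpa using hC
  | succ b =>
    obtain ⟨ψ, hψ, h1⟩ := hC
    obtain ⟨η, hη, h2⟩ := hD
    have hβ : DependsUpTo (b + 1) fun v => seqPow ω (b + 1) v + seqCoboundary b η v :=
      (dependsUpTo_seqPow ω _).add (dependsUpTo_seqCoboundary hη)
    rw [show a + 1 + (b + 1) = a + b + 1 + 1 by omega]
    -- With α = ω^(a+1) and β = ω^(b+1), the product (α + δψ)(β + δη) vanishes near both sets and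
    -- equals αβ + δ(ψ(β + δη) + αη).
    refine ⟨fun v => ψ v * (fun w => seqPow ω (b + 1) w + seqCoboundary b η w) (fun j => v (a + j))
      + seqPow ω (a + 1) v * η (fun j => v (a + 1 + j)),
      (hψ.mul (by omega) hβ).add ((dependsUpTo_seqPow ω _).mul (by omega) hη), fun x hx => ?_⟩
    have key : ∃ U ∈ 𝓝 x, ∀ v : ℕ → X, (∀ i, v i ∈ U) →
        (seqPow ω (a + 1) v + seqCoboundary a ψ v) *
          (seqPow ω (b + 1) (fun j => v (a + 1 + j)) +
            seqCoboundary b η (fun j => v (a + 1 + j))) = 0 := by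
      rcases hx with hx | hx
      · obtain ⟨U, hU, h⟩ := h1 x hx
        exact ⟨U, hU, fun v hv => by
          have e := h v hv
          beta_reduce at e
          rw [e, zero_mul]⟩
      · obtain ⟨U, hU, h⟩ := h2 x hx
        exact ⟨U, hU, fun v hv => by
          have e := h (fun j => v (a + 1 + j)) fun i => hv _
          beta_reduce at e
          rw [e, mul_zero]⟩
    obtain ⟨U, hU, h3⟩ := key
    obtain ⟨V, hV, h4⟩ := hω x hx
    refine ⟨U ∩ V, inter_mem hU hV, fun v hv => ?_⟩
    have hv1 : ∀ i, v i ∈ U := fun i => (hv i).1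
    have hv2 : ∀ i, v i ∈ V := fun i => (hv i).2
    beta_reduce
    rw [seqCoboundary_add, seqCoboundary_mul (a := a) (b := b + 1) (c := a + b + 1) (by omega) hψ
        (fun w => seqPow ω (b + 1) w + seqCoboundary b η w),
      seqCoboundary_mul (a := a + 1) (b := b) (c := a + b + 1) (by omega) (dependsUpTo_seqPow ω _),
      seqCoboundary_seqPow h4 _ hv2, seqCoboundary_add,
      seqCoboundary_seqPow h4 _ fun i => hv2 _, seqCoboundary_seqCoboundary,
      show a + b + 1 + 1 = a + 1 + (b + 1) by omega, seqPow_add ω (a + 1)]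
    linear_combination h3 v hv1

theorem PowVanishes.iUnion {ι : Type*} {s : Finset ι} {C : ι → Set X} {a : ι → ℕ}
    (hω : CocycleNear (⋃ i ∈ s, C i) ω) (h : ∀ i ∈ s, PowVanishes ω (C i) (a i)) :
    PowVanishes ω (⋃ i ∈ s, C i) (∑ i ∈ s, a i) := by
  classical
  induction s using Finset.induction_on with
  | empty => simp [PowVanishes]
  | insert i s hi ih =>
    rw [Finset.set_biUnion_insert] at hω ⊢
    rw [Finset.sum_insert hi]
    exact PowVanishes.union hω (h i (Finset.mem_insert_self _ _))
      (ih (fun x hx => hω x (Or.inr hx)) fun j hj => h j (Finset.mem_insert_of_mem hj))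

/-- Powers of cohomologous cocycles are cohomologous. -/
theorem exists_seqPow_add_eq {C : Set X} {ω' : X → X → ZMod 2} (hω : CocycleNear C ω)
    (hω' : CocycleNear C ω') (k : X → ZMod 2)
    (hk : ∀ x ∈ C, ∃ U ∈ 𝓝 x, ∀ y ∈ U, ∀ z ∈ U, ω' y z = ω y z + k y + k z) (a : ℕ) :
    ∃ η : SeqCochain X, DependsUpTo a η ∧
      VanishesNear C fun v => seqPow ω' (a + 1) v + seqPow ω (a + 1) v + seqCoboundary a η v := by
  induction a with
  | zero =>
    refine ⟨fun v => k (v 0), fun v w h => congrArg k (h 0 le_rfl), fun x hx => ?_⟩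
    obtain ⟨U, hU, h⟩ := hk x hx
    refine ⟨U, hU, fun v hv => ?_⟩
    simp only [zero_add, seqPow_one, h _ (hv 0) _ (hv 1), seqCoboundary, skip,
      Finset.sum_range_succ, Finset.range_zero, Finset.sum_empty]
    norm_num
    linear_combination zmod_two_add_self (ω (v 0) (v 1) + k (v 0) + k (v 1))
  | succ a ih =>
    obtain ⟨η, hη, h1⟩ := ih
    have hk0 : DependsUpTo 0 fun v : ℕ → X => k (v 0) := fun v w h => congrArg k (h 0 le_rfl)
    -- The difference ω'^(a+2) + ω^(a+2) equals (ω'^(a+1) + ω^(a+1)) ω' + ω^(a+1) (ω' + ω), and ω' +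
    -- ω = δk.
    refine ⟨fun v => η v * seqPow ω' 1 (fun j => v (a + j)) +
      seqPow ω (a + 1) v * (fun w : ℕ → X => k (w 0)) (fun j => v (a + 1 + j)),
      (hη.mul rfl (dependsUpTo_seqPow ω' 1)).add ((dependsUpTo_seqPow ω _).mul rfl hk0),
      fun x hx => ?_⟩
    obtain ⟨U₁, hU₁, h2⟩ := h1 x hx
    obtain ⟨U₂, hU₂, h3⟩ := hω x hx
    obtain ⟨U₃, hU₃, h4⟩ := hω' x hx
    obtain ⟨U₄, hU₄, h5⟩ := hk x hx
    refine ⟨U₁ ∩ U₂ ∩ (U₃ ∩ U₄), inter_mem (inter_mem hU₁ hU₂) (inter_mem hU₃ hU₄),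
      fun v hv => ?_⟩
    have e : seqCoboundary 0 (fun w : ℕ → X => k (w 0)) (fun j => v (a + 1 + j)) =
        k (v (a + 1 + 1)) + k (v (a + 1)) := by
      simp [seqCoboundary, skip, Finset.sum_range_succ]
    beta_reduce
    rw [seqCoboundary_add, seqCoboundary_mul rfl hη,
      seqCoboundary_mul (b := 0) rfl (dependsUpTo_seqPow ω _) (fun w : ℕ → X => k (w 0)), e,
      seqCoboundary_seqPow h3 _ fun i => (hv i).1.2,
      seqCoboundary_seqPow_one h4 fun i => (hv _).2.1, seqPow_add ω' (a + 1) 1,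
      seqPow_add ω (a + 1) 1]
    simp only [seqPow_one]
    have e1 := h5 _ (hv (a + 1)).2.2 _ (hv (a + 1 + 1)).2.2
    have e2 := h2 v fun i => (hv i).1.1
    simp only [add_zero]
    linear_combination ω' (v (a + 1)) (v (a + 1 + 1)) * e2 - seqPow ω (a + 1) v * e1

/-- Transfer of vanishing along a map that is continuous at the points of `C` and pulls `ω'` back
to a cochain cohomologous to `ω` near `C`. -/
theorem PowVanishes.pullback {Y : Type*} [TopologicalSpace Y] {C : Set X} {ω' : Y → Y → ZMod 2}
    {D : Set Y} (ρ : X → Y) (hρ : ∀ x ∈ C, ContinuousAt ρ x) (hρD : Set.MapsTo ρ C D)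
    (hω : CocycleNear C ω) (hω' : CocycleNear D ω') (k : X → ZMod 2)
    (hk : ∀ x ∈ C, ∃ U ∈ 𝓝 x, ∀ y ∈ U, ∀ z ∈ U, ω y z = ω' (ρ y) (ρ z) + k y + k z) {a : ℕ}
    (h : PowVanishes ω' D a) : PowVanishes ω C a := by
  cases a with
  | zero =>
    obtain rfl : D = ∅ := h
    exact Set.eq_empty_of_forall_notMem fun x hx => hρD hx
  | succ a =>
    obtain ⟨ψ, hψ, h1⟩ := h
    have hω'' : CocycleNear C fun y z => ω' (ρ y) (ρ z) := by
      intro x hx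
      obtain ⟨U, hU, h⟩ := hω' _ (hρD hx)
      exact ⟨ρ ⁻¹' U, hρ x hx hU, fun a ha b hb c hc => h _ ha _ hb _ hc⟩
    obtain ⟨η, hη, h2⟩ := exists_seqPow_add_eq hω'' hω k hk a
    -- Here η compares the power of ω with that of the pulled back cocycle, and ψ ∘ ρ kills the
    -- latter.
    refine ⟨fun v => η v + ψ fun j => ρ (v j), hη.add fun v w h => hψ _ _ fun i hi => by
      rw [h i hi], fun x hx => ?_⟩
    obtain ⟨U, hU, h3⟩ := h2 x hx
    obtain ⟨V, hV, h4⟩ := h1 _ (hρD hx)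
    refine ⟨U ∩ ρ ⁻¹' V, inter_mem hU (hρ x hx hV), fun v hv => ?_⟩
    have e1 := h3 v fun i => (hv i).1
    have e2 := h4 (fun j => ρ (v j)) fun i => (hv i).2
    have e3 : seqPow ω' (a + 1) (fun j => ρ (v j)) =
        seqPow (fun y z => ω' (ρ y) (ρ z)) (a + 1) v := rfl
    have e4 : seqCoboundary a (fun v => ψ fun j => ρ (v j)) v =
        seqCoboundary a ψ (fun j => ρ (v j)) := rfl
    beta_reduce at e1 e2 ⊢
    rw [seqCoboundary_add, e4]
    rw [e3] at e2
    linear_combination e1 + e2 - zmod_two_add_self (seqPow (fun y z => ω' (ρ y) (ρ z)) (a + 1) v)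

end Vanishing

/-! ### Comparison with cochains on finite tuples -/

section Comparison

variable {X : Type*}

theorem cupPow_eq (ω : Cochain X 1) (m : ℕ) (v : ℕ → X) :
    cupPow ω m (fun i => v i) = seqPow (fun y z => ω ![y, z]) m v := by
  induction m with
  | zero => simp [cupPow, seqPow]
  | succ m ih =>
    rw [seqPow, Finset.prod_range_succ]
    change cupPow ω m (fun i => v i) * ω (fun i => v (m + i)) = _
    rw [ih]
    congr 2
    funext i
    fin_cases i <;> rfl

/-- Extension of a finite tuple to a sequence. -/
def extendTuple {q : ℕ} (t : Fin (q + 1) → X) (j : ℕ) : X := t ⟨min j q, by omega⟩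

theorem extendTuple_val {q : ℕ} (t : Fin (q + 1) → X) :
    (fun i : Fin (q + 1) => extendTuple t i) = t := by
  funext i
  simp only [extendTuple]
  congr 1
  ext
  simp
  omega

theorem succAbove_val {q : ℕ} (i : Fin (q + 2)) (j : Fin (q + 1)) :
    ((i.succAbove j : Fin (q + 2)) : ℕ) = skip i j := by
  simp only [Fin.succAbove, skip, Fin.lt_def, Fin.val_castSucc]
  split_ifs <;> simp

theorem coboundary_eq {q : ℕ} (ψ : Cochain X q) (v : ℕ → X) :
    coboundary ψ (fun i => v i) = seqCoboundary q (fun w => ψ fun i => w i) v := by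
  simp only [coboundary, seqCoboundary, succAbove_val]
  rw [Finset.sum_range]

theorem pullback_cupPow {Y : Type*} (f : X → Y) (ω : Cochain Y 1) (m : ℕ) :
    PhaseTransition.pullback f (cupPow ω m) = cupPow (PhaseTransition.pullback f ω) m := by
  induction m with
  | zero => rfl
  | succ m ih =>
    funext v
    change cupPow ω m _ * ω _ = cupPow (PhaseTransition.pullback f ω) m _ * ω _
    rw [← ih]
    rfl

variable [TopologicalSpace X]

theorem powVanishes_univ_iff (ω : Cochain X 1) (m : ℕ) :
    PowVanishes (fun y z => ω ![y, z]) (Set.univ : Set X) m ↔ IsCoboundary (cupPow ω m) := by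
  cases m with
  | zero =>
    constructor
    · intro h x
      exact absurd (h ▸ Set.mem_univ x : x ∈ (∅ : Set X)) (Set.notMem_empty x)
    · intro h
      refine Set.eq_empty_of_forall_notMem fun x _ => ?_
      obtain ⟨U, hU, h⟩ := h x
      -- The zeroth power is the constant 1, which is locally zero only on the empty space.
      exact one_ne_zero (h (fun _ => x) fun _ => mem_of_mem_nhds hU)
  | succ m =>
    constructor
    · rintro ⟨ψ, hψ, h⟩
      -- The extension repeats the last entry, so it stays in every set that contains the tuple.
      refine ⟨fun t => ψ (extendTuple t), fun x => ?_⟩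
      obtain ⟨U, hU, h⟩ := h x trivial
      refine ⟨U, hU, fun t ht => ?_⟩
      have e := h (extendTuple t) fun i => ht _
      have e1 := cupPow_eq ω (m + 1) (extendTuple t)
      have e2 := coboundary_eq (q := m) (fun t => ψ (extendTuple t)) (extendTuple t)
      rw [extendTuple_val] at e1 e2
      have e3 : seqCoboundary m (fun w => ψ (extendTuple fun i : Fin (m + 1) => w i))
          (extendTuple t) = seqCoboundary m ψ (extendTuple t) := by
        refine Finset.sum_congr rfl fun i _ => hψ _ _ fun j hj => ?_
        simp only [extendTuple, min_eq_left hj]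
      beta_reduce at e
      rw [Pi.sub_apply, CharTwo.sub_eq_add, e1, e2, e3, e]
    · rintro ⟨ψ, h⟩
      refine ⟨fun w => ψ fun i => w i, fun v w h => ?_, fun x _ => ?_⟩
      · beta_reduce
        congr 1
        funext i
        exact h i (Nat.lt_succ_iff.1 i.2)
      · obtain ⟨U, hU, h⟩ := h x
        refine ⟨U, hU, fun v hv => ?_⟩
        have e := h (fun i => v i) fun i => hv i
        rwa [Pi.sub_apply, CharTwo.sub_eq_add, coboundary_eq, cupPow_eq] at e

theorem IsCocycle.exists_cocycleOn {ω : Cochain X 1} (h : IsCocycle ω) (x : X) :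
    ∃ U ∈ 𝓝 x, CocycleOn (fun y z => ω ![y, z]) U := by
  obtain ⟨U, hU, h⟩ := h x
  refine ⟨U, hU, fun a ha b hb c hc => ?_⟩
  have e := h ![a, b, c] (by intro i; fin_cases i <;> assumption)
  rw [coboundary, Fin.sum_univ_three] at e
  have h0 : (fun j => (![a, b, c] : Fin 3 → X) ((0 : Fin 3).succAbove j)) = ![b, c] := by
    funext j; fin_cases j <;> rfl
  have h1 : (fun j => (![a, b, c] : Fin 3 → X) ((1 : Fin 3).succAbove j)) = ![a, c] := by
    funext j; fin_cases j <;> rfl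
  have h2 : (fun j => (![a, b, c] : Fin 3 → X) ((2 : Fin 3).succAbove j)) = ![a, b] := by
    funext j; fin_cases j <;> rfl
  erw [h0, h1, h2] at e
  linear_combination e

end Comparison

/-! ### One-dimensional cocycles on an interval and along homotopies -/

section Interval

open unitInterval

theorem CocycleOn.self {X : Type*} {κ : X → X → ZMod 2} {U : Set X} (h : CocycleOn κ U) {a : X}
    (ha : a ∈ U) : κ a a = 0 := by
  linear_combination h a ha a ha a ha - zmod_two_add_self (κ a a)

/-- A `1`-cocycle on the unit interval is a coboundary. -/
theorem exists_primitive_unitInterval {κ : I → I → ZMod 2} (hκ : CocycleNear Set.univ κ) :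
    ∃ g : I → ZMod 2, g 1 = 0 ∧ ∀ t, ∀ᶠ s in 𝓝 t, g s = g t + κ t s := by
  have hex : ∀ x : I, ∃ U : Set I, IsOpen U ∧ x ∈ U ∧ CocycleOn κ U := by
    intro x
    obtain ⟨U, hU, h⟩ := hκ x trivial
    obtain ⟨V, hVU, hV, hx⟩ := mem_nhds_iff.1 hU
    exact ⟨V, hV, hx, fun a ha b hb c hc => h _ (hVU ha) _ (hVU hb) _ (hVU hc)⟩
  choose c hc hxc hκc using hex
  obtain ⟨t, ht0, htm, ⟨n, hn⟩, ht⟩ := exists_monotone_Icc_subset_open_cover_unitInterval hc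
    fun x _ => Set.mem_iUnion.2 ⟨x, hxc x⟩
  -- The primitive is extended across one subdivision interval at a time. Each such interval lies in
  -- a set on which κ is a cocycle, so there κ (t m) is a primitive.
  have key : ∀ m, ∃ g : I → ZMod 2, ∀ a ≤ t m, ∀ᶠ s in 𝓝 a, s ≤ t m → g s = g a + κ a s := by
    intro m
    induction m with
    | zero =>
      refine ⟨fun _ => 0, fun a ha => Eventually.of_forall fun s hs => ?_⟩
      have ha' : a = 0 := le_antisymm (ha.trans ht0.le) a.2.1
      have hs' : s = 0 := le_antisymm (hs.trans ht0.le) s.2.1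
      rw [ha', hs', (hκc 0).self (hxc 0), zero_add]
    | succ m ih =>
      obtain ⟨g, hg⟩ := ih
      obtain ⟨i, hi⟩ := ht m
      have hb : t m ∈ c i := hi ⟨le_rfl, htm (Nat.le_succ m)⟩
      refine ⟨fun s => if s ≤ t m then g s else g (t m) + κ (t m) s, fun a ha => ?_⟩
      rcases lt_trichotomy a (t m) with h | h | h
      · filter_upwards [hg a h.le, Iio_mem_nhds h] with s hs hs' _
        rw [if_pos (le_of_lt hs'), if_pos h.le, hs (le_of_lt hs')]
      · subst h
        filter_upwards [hg _ le_rfl] with s hs _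
        rw [if_pos le_rfl]
        split_ifs with h'
        · exact hs h'
        · rfl
      · have ha' : a ∈ c i := hi ⟨h.le, ha⟩
        filter_upwards [Ioi_mem_nhds h, (hc i).mem_nhds ha'] with s hs hs' _
        rw [if_neg (not_le.2 hs), if_neg (not_le.2 h)]
        linear_combination hκc i _ hb _ ha' _ hs' - zmod_two_add_self (κ (t m) a) -
          zmod_two_add_self (κ a s)
  obtain ⟨g, hg⟩ := key n
  rw [hn n le_rfl] at hg
  -- Subtracting a constant normalizes the primitive at the end point 1.
  refine ⟨fun s => g s - g 1, sub_self _, fun a => ?_⟩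
  filter_upwards [hg a a.2.2] with s hs
  rw [hs s.2.2]
  ring

/-- If the homotopy `F` contracts `T`, then primitives along the paths of `F`, normalized at the
common end point, give a primitive on `T`. -/
theorem eventually_primitive_of_contraction {T S : Type*} [TopologicalSpace T]
    [TopologicalSpace S] {κ : S → S → ZMod 2} (hκ : CocycleNear Set.univ κ) {F : T × I → S}
    (hF : Continuous F) {e : S} (he : ∀ τ, F (τ, 1) = e) {G : T → I → ZMod 2}
    (hG1 : ∀ τ, G τ 1 = 0)
    (hG : ∀ τ t, ∀ᶠ s in 𝓝 t, G τ s = G τ t + κ (F (τ, t)) (F (τ, s))) (τ₀ : T) :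
    ∀ᶠ τ in 𝓝 τ₀, G τ 0 = G τ₀ 0 + κ (F (τ₀, 0)) (F (τ, 0)) := by
  have hex : ∀ x : S, ∃ U : Set S, IsOpen U ∧ x ∈ U ∧ CocycleOn κ U := by
    intro x
    obtain ⟨U, hU, h⟩ := hκ x trivial
    obtain ⟨V, hVU, hV, hx⟩ := mem_nhds_iff.1 hU
    exact ⟨V, hV, hx, fun a ha b hb c hc => h _ (hVU ha) _ (hVU hb) _ (hVU hc)⟩
  -- Tube lemma: by compactness of the interval, the paths of τ and τ₀ stay together, at each time,
  -- in one set on which κ is a cocycle.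
  have h1 : ∀ᶠ τ in 𝓝 τ₀, ∀ t ∈ (Set.univ : Set I),
      ∃ U : Set S, IsOpen U ∧ CocycleOn κ U ∧ F (τ₀, t) ∈ U ∧ F (τ, t) ∈ U := by
    refine isCompact_univ.eventually_forall_of_forall_eventually fun t _ => ?_
    obtain ⟨U, hU, hx, hc⟩ := hex (F (τ₀, t))
    have h2 : ∀ᶠ z : T × I in 𝓝 (τ₀, t), F (z.1, z.2) ∈ U :=
      hF.continuousAt.eventually (hU.mem_nhds hx)
    have h3 : ∀ᶠ z : T × I in 𝓝 (τ₀, t), F (τ₀, z.2) ∈ U := by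
      have : ContinuousAt (fun z : T × I => F (τ₀, z.2)) (τ₀, t) := by fun_prop
      exact this.eventually (hU.mem_nhds hx)
    filter_upwards [h2, h3] with z hz hz'
    exact ⟨U, hU, hc, hz', hz⟩
  filter_upwards [h1] with τ hτ
  -- The defect of the claimed identity at time t is locally constant in t, and it vanishes at t =
  -- 1, where both paths have arrived at e.
  have h2 : IsLocallyConstant fun t => G τ t + G τ₀ t + κ (F (τ₀, t)) (F (τ, t)) := by
    rw [IsLocallyConstant.iff_eventually_eq]
    intro t
    obtain ⟨U, hU, hc, ha, hb⟩ := hτ t trivial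
    have c1 : ContinuousAt (fun s => F (τ₀, s)) t := by fun_prop
    have c2 : ContinuousAt (fun s => F (τ, s)) t := by fun_prop
    filter_upwards [hG τ t, hG τ₀ t, c1.eventually (hU.mem_nhds ha),
      c2.eventually (hU.mem_nhds hb)] with s h1 h2 h3 h4
    rw [h1, h2]
    have e1 := hc _ ha _ h3 _ h4
    have e2 := hc _ ha _ hb _ h4
    linear_combination e1 + e2 - zmod_two_add_self (κ (F (τ₀, t)) (F (τ, s))) -
      zmod_two_add_self (κ (F (τ₀, t)) (F (τ, t)))
  have h3 := h2.apply_eq_of_preconnectedSpace 0 1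
  obtain ⟨U, -, hxe, hc⟩ := hex e
  simp only [hG1, he, hc.self hxe, add_zero] at h3
  linear_combination h3 - zmod_two_add_self (G τ₀ 0) - zmod_two_add_self (κ (F (τ₀, 0)) (F (τ, 0)))

end Interval

/-! ### The infinite sphere -/

section Sphere

open unitInterval

/-- The sum of the squares of the coordinates. -/
def sqNorm (y : ℕ →₀ ℝ) : ℝ := y.sum fun _ t => t ^ 2

theorem sqNorm_smul (a : ℝ) (y : ℕ →₀ ℝ) : sqNorm (a • y) = a ^ 2 * sqNorm y := by
  rw [sqNorm, Finsupp.sum_smul_index (by simp), sqNorm, Finsupp.mul_sum]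
  simp only [mul_pow]

theorem sqNorm_neg (y : ℕ →₀ ℝ) : sqNorm (-y) = sqNorm y := by
  have := sqNorm_smul (-1) y
  simpa using this

theorem sqNorm_pos {y : ℕ →₀ ℝ} (hy : y ≠ 0) : 0 < sqNorm y := by
  refine Finset.sum_pos (fun i hi => ?_) (Finsupp.support_nonempty_iff.2 hy)
  have := Finsupp.mem_support_iff.1 hi
  positivity

theorem sqNorm_eq {k : ℕ} {y : ℕ →₀ ℝ} (hy : ∀ i, k < i → y i = 0) :
    sqNorm y = ∑ i ∈ Finset.range (k + 1), y i ^ 2 := by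
  refine Finsupp.sum_of_support_subset _ (fun i hi => ?_) _ (by simp)
  rw [Finset.mem_range, Nat.lt_succ_iff]
  by_contra h
  exact Finsupp.mem_support_iff.1 hi (hy i (not_le.1 h))

/-- Radial projection to the sphere. -/
def toSphere (y : ℕ →₀ ℝ) (hy : y ≠ 0) : SphereInf :=
  ⟨(Real.sqrt (sqNorm y))⁻¹ • y, by
    change sqNorm _ = 1
    rw [sqNorm_smul, inv_pow, Real.sq_sqrt (sqNorm_pos hy).le, inv_mul_cancel₀ (sqNorm_pos hy).ne']⟩

theorem SphereInf.sqNorm_eq_one (x : SphereInf) : sqNorm x.1 = 1 := x.2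

theorem toSphere_val (x : SphereInf) (hy : x.1 ≠ 0) : toSphere x.1 hy = x := by
  apply Subtype.ext
  simp [toSphere, x.sqNorm_eq_one]

theorem SphereInf.ne_zero (x : SphereInf) : x.1 ≠ 0 := by
  intro h
  have := x.sqNorm_eq_one
  rw [h] at this
  simp [sqNorm] at this

/-- The antipodal map. -/
def SphereInf.neg (x : SphereInf) : SphereInf := ⟨-x.1, (sqNorm_neg x.1).trans x.2⟩

theorem continuous_stage_val (k : ℕ) : Continuous fun x : SphereStage k => x.1 :=
  continuous_iff_coinduced_le.2
    (le_iSup (fun k : ℕ =>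
      TopologicalSpace.coinduced (fun x : SphereStage k => x.1) inferInstance) k)

/-- A point of the infinite sphere as a point of a finite dimensional sphere. -/
def SphereInf.toStage (k : ℕ) (x : SphereInf) (hx : ∀ i, k < i → x.1 i = 0) : SphereStage k :=
  ⟨x, hx⟩

/-- The direct limit topology is finer than the coordinatewise one; the two notions of continuity
agree when all values lie in one finite stage. -/
theorem continuous_sphereInf_of_coord {T : Type*} [TopologicalSpace T] (k : ℕ) {F : T → SphereInf}
    (hs : ∀ t i, k < i → (F t).1 i = 0) (hc : ∀ i, Continuous fun t => (F t).1 i) :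
    Continuous F := by
  have h : Continuous fun t => (F t).toStage k (hs t) :=
    continuous_induced_rng.2 (continuous_pi hc :)
  exact (continuous_stage_val k).comp h

theorem continuous_toSphere {T : Type*} [TopologicalSpace T] (k : ℕ) {y : T → ℕ →₀ ℝ}
    (hs : ∀ t i, k < i → y t i = 0) (hc : ∀ i, Continuous fun t => y t i) (hy : ∀ t, y t ≠ 0) :
    Continuous fun t => toSphere (y t) (hy t) := by
  refine continuous_sphereInf_of_coord k (fun t i hi => ?_) fun i => ?_
  · simp [toSphere, hs t i hi]
  · simp only [toSphere, Finsupp.smul_apply, smul_eq_mul]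
    have : Continuous fun t => sqNorm (y t) := by
      simp only [fun t => sqNorm_eq (hs t)]
      fun_prop
    exact (this.sqrt.inv₀ fun t => (Real.sqrt_pos.2 (sqNorm_pos (hy t))).ne').mul (hc i)

theorem continuous_stage_coord (k i : ℕ) : Continuous fun x : SphereStage k => x.1.1 i :=
  (continuous_apply i).comp continuous_induced_dom

theorem continuous_sphereInf_dom {Y : Type*} [TopologicalSpace Y] {f : SphereInf → Y}
    (h : ∀ k, Continuous fun x : SphereStage k => f x.1) : Continuous f :=
  continuous_iSup_dom.2 fun k => continuous_coinduced_dom.2 (h k)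

theorem isOpen_sphereInf_iff {V : Set SphereInf} :
    IsOpen V ↔ ∀ k, IsOpen {x : SphereStage k | x.1 ∈ V} := by
  rw [isOpen_iSup_iff]
  rfl

theorem continuous_sphereInf_neg : Continuous SphereInf.neg := by
  refine continuous_sphereInf_dom fun k => continuous_sphereInf_of_coord k (fun x i hi => ?_)
    fun i => ?_
  · simp [SphereInf.neg, x.2 i hi]
  · exact (continuous_stage_coord k i).neg

/-- A path in `ℝ^∞` from `y` to the first basis vector. -/
def basePath (y : ℕ →₀ ℝ) (t : ℝ) : ℕ →₀ ℝ :=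
  (1 - t) • y + (t * (1 - t)) • y.mapDomain Nat.succ + Finsupp.single 0 t

theorem mapDomain_succ_apply (y : ℕ →₀ ℝ) (i : ℕ) :
    y.mapDomain Nat.succ (i + 1) = y i := Finsupp.mapDomain_apply Nat.succ_injective y i

theorem basePath_succ (y : ℕ →₀ ℝ) (t : ℝ) (i : ℕ) :
    basePath y t (i + 1) = (1 - t) * y (i + 1) + t * (1 - t) * y i := by
  simp [basePath, mapDomain_succ_apply]

/-- For t ≠ 1, a zero of the path forces y (i + 1) = -t y i. If t ≠ 0, one nonzero coordinate then
makes all later ones nonzero, against finite support; at t = 0 the path is y itself, and at t = 1 it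
is the basis vector. The shifted copy of y is what keeps the path off the origin when y is a
negative multiple of that vector. -/
theorem basePath_ne_zero {y : ℕ →₀ ℝ} (hy : y ≠ 0) (t : ℝ) : basePath y t ≠ 0 := by
  intro h
  by_cases ht1 : t = 1
  · have := DFunLike.congr_fun h 0
    simp [basePath, ht1] at this
  have h1 : ∀ i, y (i + 1) = -t * y i := by
    intro i
    have := DFunLike.congr_fun h (i + 1)
    rw [basePath_succ, Finsupp.zero_apply] at this
    have h' : (1 - t) * (y (i + 1) + t * y i) = 0 := by linear_combination this
    rcases mul_eq_zero.1 h' with h' | h'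
    · exact absurd (by linarith) ht1
    · linarith
  obtain ⟨i, hi⟩ := DFunLike.ne_iff.1 hy
  rw [Finsupp.zero_apply] at hi
  by_cases ht0 : t = 0
  · apply hi
    have := DFunLike.congr_fun h i
    simpa [basePath, ht0] using this
  · have h2 : ∀ j, y (i + j) ≠ 0 := by
      intro j
      induction j with
      | zero => exact hi
      | succ j ih =>
        rw [← add_assoc, h1]
        exact mul_ne_zero (neg_ne_zero.2 ht0) ih
    have h3 : Set.Infinite (↑y.support : Set ℕ) :=
      Set.infinite_of_injective_forall_mem (f := fun j => i + j) (add_right_injective i)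
        fun j => Finset.mem_coe.2 (Finsupp.mem_support_iff.2 (h2 j))
    exact h3 (Finset.finite_toSet _)

/-- The contraction of the infinite sphere to a point. -/
def contraction (z : SphereInf × I) : SphereInf :=
  toSphere (basePath z.1.1 z.2) (basePath_ne_zero z.1.ne_zero z.2)

theorem toSphere_congr {y z : ℕ →₀ ℝ} (h : y = z) (hy : y ≠ 0) (hz : z ≠ 0) :
    toSphere y hy = toSphere z hz := by
  subst h
  rfl

theorem contraction_zero (x : SphereInf) : contraction (x, 0) = x := by
  rw [contraction, toSphere_congr (z := x.1) (by simp [basePath]) _ x.ne_zero, toSphere_val]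

theorem contraction_one (x : SphereInf) :
    contraction (x, 1) = toSphere (Finsupp.single 0 1) (by simp) :=
  toSphere_congr (by simp [basePath]) _ _

/-- The shift moves stage k into stage k + 1, where continuity is coordinatewise. Working on one
stage avoids products with the direct limit topology. -/
theorem continuous_contraction_stage (k : ℕ) :
    Continuous fun z : SphereStage k × I => contraction (z.1.1, z.2) := by
  refine continuous_toSphere (k + 1) (fun z i hi => ?_) (fun i => ?_) _
  · obtain ⟨i, rfl⟩ : ∃ j, i = j + 1 := ⟨i - 1, by omega⟩
    rw [basePath_succ, z.1.2 (i + 1) (by omega), z.1.2 i (by omega)]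
    ring
  · have h : ∀ j, Continuous fun z : SphereStage k × I => z.1.1.1 j :=
      fun j => (continuous_stage_coord k j).comp continuous_fst
    cases i with
    | zero =>
      have : ∀ z : SphereStage k × I,
          basePath z.1.1.1 z.2 0 = (1 - (z.2 : ℝ)) * z.1.1.1 0 + z.2 := by
        intro z
        have : z.1.1.1.mapDomain Nat.succ 0 = 0 :=
          Finsupp.mapDomain_of_notMem_range _ _ (by simp)
        simp [basePath, this]
      simp only [this]
      have := h 0
      fun_prop
    | succ i =>
      simp only [basePath_succ]
      have h1 := h i
      have h2 := h (i + 1)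
      fun_prop

theorem exists_mem_stage (x : SphereInf) : ∃ k, ∀ i, k < i → x.1 i = 0 := by
  refine ⟨x.1.support.sup id, fun i hi => ?_⟩
  by_contra h
  exact absurd (Finset.le_sup (f := id) (Finsupp.mem_support_iff.2 h)) (not_le.2 hi)

theorem continuous_contraction_path (x : SphereInf) :
    Continuous fun t : I => contraction (x, t) := by
  obtain ⟨k, hk⟩ := exists_mem_stage x
  have h : Continuous fun t : I => (x.toStage k hk, t) := continuous_const.prodMk continuous_id
  have := (continuous_contraction_stage k).comp h
  exact this

/-- The first cohomology of the infinite sphere is trivial. -/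
theorem exists_primitive_sphereInf {κ : SphereInf → SphereInf → ZMod 2}
    (hκ : CocycleNear Set.univ κ) :
    ∃ h : SphereInf → ZMod 2, ∀ x, ∃ U ∈ 𝓝 x, ∀ y ∈ U, ∀ z ∈ U, κ y z = h y + h z := by
  have hpath : ∀ x : SphereInf, ∃ g : I → ZMod 2, g 1 = 0 ∧
      ∀ t, ∀ᶠ s in 𝓝 t, g s = g t + κ (contraction (x, t)) (contraction (x, s)) := by
    intro x
    refine exists_primitive_unitInterval
      (κ := fun t s => κ (contraction (x, t)) (contraction (x, s))) fun t _ => ?_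
    obtain ⟨U, hU, h⟩ := hκ (contraction (x, t)) trivial
    exact ⟨_, (continuous_contraction_path x).continuousAt.preimage_mem_nhds hU,
      fun a ha b hb c hc => h _ ha _ hb _ hc⟩
  choose G hG1 hG using hpath
  have hstage : ∀ k (x₀ : SphereStage k), ∀ᶠ x : SphereStage k in 𝓝 x₀,
      G x.1 0 = G x₀.1 0 + κ x₀.1 x.1 := by
    intro k x₀
    have := eventually_primitive_of_contraction hκ (continuous_contraction_stage k)
      (fun τ => contraction_one τ.1) (G := fun τ => G τ.1) (fun τ => hG1 τ.1) (fun τ => hG τ.1) x₀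
    simpa only [contraction_zero] using this
  -- The primitive at x is obtained by integrating κ along the contraction path of x.
  refine ⟨fun x => G x 0, fun x => ?_⟩
  obtain ⟨U, hU, h⟩ := hκ x trivial
  obtain ⟨V, hVU, hV, hx⟩ := mem_nhds_iff.1 hU
  -- The identity is known only near points within a single stage; since openness in the limit
  -- topology is tested on stages, this yields a true neighbourhood of x.
  have hopen : IsOpen {y | y ∈ V ∧ G y 0 = G x 0 + κ x y} := by
    rw [isOpen_sphereInf_iff]
    intro k
    rw [isOpen_iff_eventually]
    rintro y ⟨hyV, hy⟩
    filter_upwards [hstage k y,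
      ((continuous_stage_val k).isOpen_preimage V hV).mem_nhds hyV] with z hz hzV
    refine ⟨hzV, ?_⟩
    have := h _ (hVU hx) _ (hVU hyV) _ (hVU hzV)
    linear_combination hz + hy + this - zmod_two_add_self (κ x z.1)
  refine ⟨_, hopen.mem_nhds ⟨hx, ?_⟩, fun y hy z hz => ?_⟩
  · rw [CocycleOn.self h (hVU hx), add_zero]
  · have := h _ (hVU hx) _ (hVU hy.1) _ (hVU hz.1)
    beta_reduce
    rw [hy.2, hz.2]
    linear_combination this - zmod_two_add_self (G x 0) - zmod_two_add_self (κ x y) -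
      zmod_two_add_self (κ x z)

/-- The contraction joins every point to the same base point. -/
theorem isLocallyConstant_sphereInf {h : SphereInf → ZMod 2} (hh : IsLocallyConstant h)
    (x y : SphereInf) : h x = h y := by
  have key : ∀ x, h x = h (toSphere (Finsupp.single 0 1) (by simp)) := by
    intro x
    have := (hh.comp_continuous (continuous_contraction_path x)).apply_eq_of_preconnectedSpace 0 1
    simpa only [Function.comp, contraction_zero, contraction_one] using this
  rw [key x, key y]

/-- The class of `x` in the projective space. -/
def SphereInf.proj (x : SphereInf) : RPInf := Quotient.mk _ x

theorem continuous_proj : Continuous SphereInf.proj := continuous_quotient_mk'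

theorem proj_neg (x : SphereInf) : x.neg.proj = x.proj := Quotient.sound (Or.inr rfl)

theorem eq_or_eq_neg_of_proj_eq {x y : SphereInf} (h : x.proj = y.proj) : x = y ∨ x = y.neg := by
  rcases Quotient.exact h with h | h
  · exact Or.inl (Subtype.ext h)
  · exact Or.inr (Subtype.ext h)

theorem isOpenMap_proj : IsOpenMap SphereInf.proj := by
  intro U hU
  refine isQuotientMap_quotient_mk'.isOpen_preimage.1 ?_
  have : SphereInf.proj ⁻¹' (SphereInf.proj '' U) =
      U ∪ SphereInf.neg ⁻¹' U := by
    ext x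
    constructor
    · rintro ⟨y, hy, h⟩
      rcases eq_or_eq_neg_of_proj_eq h with rfl | rfl
      · exact Or.inl hy
      · exact Or.inr hy
    · rintro (h | h)
      · exact ⟨x, h, rfl⟩
      · exact ⟨_, h, proj_neg x⟩
  exact this ▸ hU.union (hU.preimage continuous_sphereInf_neg)

/-- The nonzero class in `H¹(ℝP^∞; ℤ/2)` is the class of the double covering by the sphere. -/
theorem exists_odd_primitive {ω : Cochain RPInf 1} (hω : IsCocycle ω) (hn : ¬ IsCoboundary ω) :
    ∃ h : SphereInf → ZMod 2, (∀ x, h x.neg = h x + 1) ∧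
      ∀ x, ∃ U ∈ 𝓝 x, ∀ y ∈ U, ∀ z ∈ U, ω ![y.proj, z.proj] = h y + h z := by
  obtain ⟨h, hh⟩ := exists_primitive_sphereInf (κ := fun y z => ω ![y.proj, z.proj]) (by
    intro x _
    obtain ⟨U, hU, h⟩ := hω.exists_cocycleOn x.proj
    exact ⟨_, continuous_proj.continuousAt.preimage_mem_nhds hU,
      fun a ha b hb c hc => h _ ha _ hb _ hc⟩)
  refine ⟨h, ?_, hh⟩
  -- The lift of ω is invariant under the antipodal map, so h(-x) and h(x) have the same local
  -- increments.
  have hloc : IsLocallyConstant fun x => h x.neg + h x := by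
    rw [IsLocallyConstant.iff_eventually_eq]
    intro x
    obtain ⟨U, hU, h1⟩ := hh x
    obtain ⟨V, hV, h2⟩ := hh x.neg
    filter_upwards [hU, continuous_sphereInf_neg.continuousAt.preimage_mem_nhds hV] with y hy hy'
    have e1 := h1 _ hy _ (mem_of_mem_nhds hU)
    have e2 := h2 _ hy' _ (mem_of_mem_nhds hV)
    simp only [proj_neg] at e2
    linear_combination e1 - e2 + zmod_two_add_self (h y) - zmod_two_add_self (h x.neg)
  have hconst := isLocallyConstant_sphereInf hloc
  by_contra hcon
  push Not at hcon
  obtain ⟨x₀, hx₀⟩ := hcon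
  -- If the constant h(-x) + h(x) is not 1, it is 0; then h descends to a primitive of ω on the
  -- projective space, against the choice of ω.
  have h0 : ∀ x, h x.neg = h x := by
    intro x
    have h1 : h x.neg + h x = h x₀.neg + h x₀ := hconst x x₀
    have h2 : h x₀.neg + h x₀ = 0 := by
      revert hx₀
      generalize h x₀.neg = a
      generalize h x₀ = b
      revert a b
      decide
    linear_combination h1 + h2 - zmod_two_add_self (h x)
  apply hn
  have hlift : ∀ x y : SphereInf, x.proj = y.proj → h x = h y := by
    intro x y hxy
    rcases eq_or_eq_neg_of_proj_eq hxy with rfl | rfl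
    · rfl
    · exact h0 y
  refine ⟨fun t => h (t 0).out, fun X => ?_⟩
  obtain ⟨x, rfl⟩ : ∃ x : SphereInf, x.proj = X := Quotient.exists_rep X
  obtain ⟨U, hU, h1⟩ := hh x
  refine ⟨_, isOpenMap_proj.image_mem_nhds hU, fun v hv => ?_⟩
  obtain ⟨y, hy, hy'⟩ := hv 0
  obtain ⟨z, hz, hz'⟩ := hv 1
  have e := h1 _ hy _ hz
  have ev : v = ![y.proj, z.proj] := by
    funext i
    fin_cases i
    · exact hy'.symm
    · exact hz'.symm
  have e0 : h (v 0).out = h y := hlift _ _ ((Quotient.out_eq (v 0)).trans hy'.symm)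
  have e1 : h (v 1).out = h z := hlift _ _ ((Quotient.out_eq (v 1)).trans hz'.symm)
  have ec : coboundary (fun t : Fin 1 → RPInf => h (t 0).out) v = h (v 1).out + h (v 0).out := by
    rw [coboundary, Fin.sum_univ_two]
    rfl
  rw [Pi.sub_apply, ec, e0, e1, ev, e]
  ring

end Sphere

/-! ### Odd maps and the index -/

section Orbit

variable {E : Type*} [NormedAddCommGroup E]

/-- The class of a point in the orbit space. -/
def orbit {A : Set E} (x : A) : OrbitSpace A := Quotient.mk _ x

theorem orbit_eq_iff {A : Set E} {x y : A} :
    orbit x = orbit y ↔ (x : E) = y ∨ (x : E) = -y := Quotient.eq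

theorem continuous_orbit {A : Set E} : Continuous (orbit : A → OrbitSpace A) :=
  continuous_quotient_mk'

/-- The antipodal map of a symmetric set. -/
def antipode {A : Set E} (hA : ∀ u ∈ A, -u ∈ A) (x : A) : A := ⟨-x, hA x x.2⟩

theorem continuous_antipode {A : Set E} (hA : ∀ u ∈ A, -u ∈ A) : Continuous (antipode hA) := by
  unfold antipode
  fun_prop

theorem isOpenMap_orbit {A : Set E} (hA : ∀ u ∈ A, -u ∈ A) :
    IsOpenMap (orbit : A → OrbitSpace A) := by
  intro U hU
  refine isQuotientMap_quotient_mk'.isOpen_preimage.1 ?_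
  have : orbit ⁻¹' (orbit '' U) = U ∪ antipode hA ⁻¹' U := by
    ext x
    constructor
    · rintro ⟨y, hy, h⟩
      rcases orbit_eq_iff.1 h with h | h
      · exact Or.inl (Subtype.ext h ▸ hy)
      · have : y = antipode hA x := Subtype.ext h
        exact Or.inr (Set.mem_preimage.2 (this ▸ hy))
    · rintro (h | h)
      · exact ⟨x, h, rfl⟩
      · exact ⟨_, h, orbit_eq_iff.2 (Or.inr rfl)⟩
  exact this ▸ hU.union (hU.preimage (continuous_antipode hA))

/-- `θ` is the difference cocycle of the odd function `h`. -/
def IsOddPrimitive {A : Set E} (θ : OrbitSpace A → OrbitSpace A → ZMod 2) (h : A → ZMod 2) :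
    Prop :=
  (∀ x y : A, (y : E) = -x → h y = h x + 1) ∧
    ∀ x, ∃ U ∈ 𝓝 x, ∀ y ∈ U, ∀ z ∈ U, θ (orbit y) (orbit z) = h y + h z

theorem IsOddPrimitive.cocycleNear {A : Set E} (hA : ∀ u ∈ A, -u ∈ A)
    {θ : OrbitSpace A → OrbitSpace A → ZMod 2} {h : A → ZMod 2} (hθ : IsOddPrimitive θ h)
    (S : Set (OrbitSpace A)) : CocycleNear S θ := by
  intro X _
  obtain ⟨x, rfl⟩ : ∃ x : A, orbit x = X := Quotient.exists_rep X
  obtain ⟨U, hU, h1⟩ := hθ.2 x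
  refine ⟨_, (isOpenMap_orbit hA).image_mem_nhds hU, ?_⟩
  rintro _ ⟨a, ha, rfl⟩ _ ⟨b, hb, rfl⟩ _ ⟨c, hc, rfl⟩
  rw [h1 a ha b hb, h1 b hb c hc, h1 a ha c hc]
  linear_combination zmod_two_add_self (h a) + zmod_two_add_self (h b) + zmod_two_add_self (h c)

/-- The pulled back cocycle has an odd primitive upstairs. This is all that is retained of the odd
map, and it makes pull-backs by unrelated odd maps comparable. -/
theorem OddMap.isOddPrimitive {A : Set E} (f : OddMap A) {ω : Cochain RPInf 1}
    {h : SphereInf → ZMod 2} (h1 : ∀ x, h x.neg = h x + 1)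
    (h2 : ∀ x, ∃ U ∈ 𝓝 x, ∀ y ∈ U, ∀ z ∈ U, ω ![y.proj, z.proj] = h y + h z) :
    IsOddPrimitive (fun X Y => PhaseTransition.pullback f.descend ω ![X, Y])
      fun x => h (f.toFun x) := by
  constructor
  · intro x y hxy
    have : f.toFun y = (f.toFun x).neg := Subtype.ext (f.odd x y hxy)
    beta_reduce
    rw [this, h1]
  · intro x
    obtain ⟨U, hU, h⟩ := h2 (f.toFun x)
    refine ⟨_, f.continuous_toFun.continuousAt.preimage_mem_nhds hU, fun y hy z hz => ?_⟩
    rw [← h _ hy _ hz]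
    simp only [PhaseTransition.pullback]
    congr 1
    funext i
    fin_cases i <;> rfl

/-- Transfer of vanishing powers from the image of a closed symmetric subset. -/
theorem PowVanishes.of_image {E' : Type*} [NormedAddCommGroup E'] {A C : Set E}
    (hA : ∀ u ∈ A, -u ∈ A) (hC : IsCompact C) (hCs : ∀ u ∈ C, -u ∈ C) {R : E → E'}
    (hR : Continuous R) (hRn : ∀ u, R (-u) = -R u)
    {θ : OrbitSpace A → OrbitSpace A → ZMod 2} {h : A → ZMod 2} (hθ : IsOddPrimitive θ h)
    {θ' : OrbitSpace (R '' C) → OrbitSpace (R '' C) → ZMod 2} {h' : R '' C → ZMod 2}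
    (hθ' : IsOddPrimitive θ' h') {a : ℕ} (hv : PowVanishes θ' Set.univ a) :
    PowVanishes θ (orbit '' {x : A | (x : E) ∈ C}) a := by
  rcases C.eq_empty_or_nonempty with rfl | hCne
  · simpa using powVanishes_empty a
  have hDs : ∀ u ∈ R '' C, -u ∈ R '' C := by
    rintro _ ⟨u, hu, rfl⟩
    exact ⟨-u, hCs u hu, hRn u⟩
  -- A nearest point map onto C replaces a neighbourhood retraction. It may be discontinuous off C
  -- and need not be odd there, but it fixes C and is continuous at each point of C, since dist (σ
  -- x) c ≤ 2 dist x c.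
  have hnear : ∀ x : A, ∃ c ∈ C, Metric.infDist (x : E) C = dist (x : E) c :=
    fun x => hC.exists_infDist_eq_dist hCne x
  choose σ hσC hσ using hnear
  have hσc : ∀ c : A, (c : E) ∈ C → σ c = c := by
    intro c hc
    have := hσ c
    rw [Metric.infDist_zero_of_mem hc] at this
    exact (dist_eq_zero.1 this.symm).symm
  have hσcont : ∀ c : A, (c : E) ∈ C → ContinuousAt σ c := by
    intro c hc
    rw [ContinuousAt, hσc c hc, tendsto_iff_dist_tendsto_zero]
    have hb : ∀ x : A, dist (σ x) (c : E) ≤ 2 * dist x c := by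
      intro x
      have h1 : dist (x : E) (σ x) ≤ dist (x : E) c := hσ x ▸ Metric.infDist_le_dist_of_mem hc
      have h2 := dist_triangle_left (σ x) (c : E) (x : E)
      have h3 : dist x c = dist (x : E) c := rfl
      linarith
    refine squeeze_zero (fun _ => dist_nonneg) hb ?_
    have : Continuous fun x : A => 2 * dist x c := by fun_prop
    simpa using this.tendsto c
  let τ : A → R '' C := fun x => ⟨R (σ x), σ x, hσC x, rfl⟩
  have hτcont : ∀ c : A, (c : E) ∈ C → ContinuousAt τ c := by
    intro c hc
    rw [ContinuousAt, tendsto_subtype_rng]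
    exact hR.continuousAt.comp (hσcont c hc)
  have hτneg : ∀ c : A, (c : E) ∈ C → τ (antipode hA c) = antipode hDs (τ c) := by
    intro c hc
    apply Subtype.ext
    change R (σ (antipode hA c)) = -R (σ c)
    rw [hσc c hc, hσc _ (hCs c hc), ← hRn]
    rfl
  -- A representative of each orbit is chosen arbitrarily; k records the difference of the two odd
  -- primitives at that choice.
  let ρ : OrbitSpace A → OrbitSpace (R '' C) := fun X => orbit (τ X.out)
  let k : OrbitSpace A → ZMod 2 := fun X => h X.out + h' (τ X.out)
  have hout : ∀ x : A, (orbit x).out = x ∨ (orbit x).out = antipode hA x := by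
    intro x
    have : orbit (orbit x).out = orbit x := Quotient.out_eq _
    rcases orbit_eq_iff.1 this with h | h
    · exact Or.inl (Subtype.ext h)
    · exact Or.inr (Subtype.ext h)
  have hρ : ∀ c : A, (c : E) ∈ C → ρ (orbit c) = orbit (τ c) := by
    intro c hc
    change orbit (τ (orbit c).out) = _
    rcases hout c with h | h
    · rw [h]
    · rw [h, hτneg c hc]
      exact orbit_eq_iff.2 (Or.inr rfl)
  -- Near the orbit of c, the chosen representative may be close to -c instead of c. Changing both
  -- signs adds 1 to h and 1 to h', so k is unaffected. Continuity of τ at -c keeps the second point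
  -- close to τ c.
  have key : ∀ c : A, (c : E) ∈ C → ∀ U ∈ 𝓝 c, ∀ V ∈ 𝓝 (τ c), ∀ᶠ X in 𝓝 (orbit c),
      ∃ x ∈ U, ∃ y ∈ V, X = orbit x ∧ ρ X = orbit y ∧ k X = h x + h' y := by
    intro c hc U hU V hV
    have h1 : τ ⁻¹' V ∈ 𝓝 c := hτcont c hc hV
    have h2 : antipode hA ⁻¹' (τ ⁻¹' (antipode hDs ⁻¹' V)) ∈ 𝓝 c := by
      refine (continuous_antipode hA).continuousAt.preimage_mem_nhds
        (hτcont (antipode hA c) (hCs c hc) ?_)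
      refine (continuous_antipode hDs).continuousAt.preimage_mem_nhds ?_
      rw [hτneg c hc]
      have : antipode hDs (antipode hDs (τ c)) = τ c := Subtype.ext (neg_neg _)
      rwa [this]
    filter_upwards [(isOpenMap_orbit hA).image_mem_nhds (inter_mem hU (inter_mem h1 h2))]
    rintro _ ⟨x, ⟨hxU, hx1, hx2⟩, rfl⟩
    rcases hout x with ho | ho
    · refine ⟨x, hxU, τ x, hx1, rfl, ?_, ?_⟩
      · change orbit (τ (orbit x).out) = _
        rw [ho]
      · change h (orbit x).out + h' (τ (orbit x).out) = _
        rw [ho]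
    · refine ⟨x, hxU, antipode hDs (τ (antipode hA x)), hx2, rfl, ?_, ?_⟩
      · change orbit (τ (orbit x).out) = _
        rw [ho]
        exact orbit_eq_iff.2 (Or.inr (neg_neg _).symm)
      · change h (orbit x).out + h' (τ (orbit x).out) = _
        rw [ho, hθ.1 x (antipode hA x) rfl,
          hθ'.1 (τ (antipode hA x)) (antipode hDs (τ (antipode hA x))) rfl]
        ring
  refine PowVanishes.pullback ρ ?_ (Set.mapsTo_univ _ _) (hθ.cocycleNear hA _)
    (hθ'.cocycleNear hDs _) k ?_ hv
  · rintro _ ⟨c, hc, rfl⟩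
    rw [ContinuousAt, hρ c hc]
    intro W hW
    rw [Filter.mem_map]
    filter_upwards [key c hc Set.univ univ_mem _
      (continuous_orbit.continuousAt.preimage_mem_nhds hW)]
    rintro X ⟨x, -, y, hy, -, hρX, -⟩
    rw [Set.mem_preimage, hρX]
    exact hy
  · rintro _ ⟨c, hc, rfl⟩
    obtain ⟨U, hU, h1⟩ := hθ.2 c
    obtain ⟨V, hV, h2⟩ := hθ'.2 (τ c)
    refine ⟨_, key c hc U hU V hV, ?_⟩
    rintro X ⟨x, hx, y, hy, hX, hρX, hkX⟩ Z ⟨x', hx', y', hy', hZ, hρZ, hkZ⟩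
    rw [hρX, hρZ, hkX, hkZ, hX, hZ, h1 x hx x' hx', h2 y hy y' hy']
    linear_combination -zmod_two_add_self (h' y) - zmod_two_add_self (h' y')

end Orbit

/-- Compact symmetric sets that avoid the origin admit odd maps to the infinite sphere. -/
theorem nonempty_oddMap {E : Type*} [NormedAddCommGroup E] [NormedSpace ℝ E] {D : Set E}
    (hD : IsCompact D) (h0 : (0 : E) ∉ D) : Nonempty (OddMap D) := by
  have hdual : ∀ x : D, ∃ l : E →L[ℝ] ℝ, l x ≠ 0 := by
    intro x
    have hx : (x : E) ≠ 0 := fun h => h0 (h ▸ x.2)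
    obtain ⟨l, -, hl⟩ := exists_dual_vector ℝ (x : E) (norm_ne_zero_iff.2 hx)
    refine ⟨l, ?_⟩
    rw [hl]
    simpa using hx
  choose l hl using hdual
  -- By compactness, finitely many functionals have no common zero on D; they are the coordinates of
  -- an odd map, which is then projected radially to the sphere.
  obtain ⟨s, hs⟩ := hD.elim_finite_subcover (fun x : D => {y | l x y ≠ 0})
    (fun x => isOpen_ne_fun (l x).continuous continuous_const)
    fun x hx => Set.mem_iUnion.2 ⟨⟨x, hx⟩, hl ⟨x, hx⟩⟩
  let L : ℕ → E →L[ℝ] ℝ := fun i => if hi : i < s.card then l (s.equivFin.symm ⟨i, hi⟩) else 0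
  let F : D → ℕ →₀ ℝ := fun x => Finsupp.onFinset (Finset.range s.card) (fun i => L i x) (by
    intro i hi
    rw [Finset.mem_range]
    by_contra hcon
    apply hi
    simp only [L, dif_neg hcon, _root_.zero_apply])
  have hF : ∀ x i, F x i = L i x := fun _ _ => rfl
  have hF0 : ∀ x, F x ≠ 0 := by
    intro x hx
    obtain ⟨y, hy, hxy⟩ := Set.mem_iUnion₂.1 (hs x.2)
    apply hxy
    have := DFunLike.congr_fun hx (s.equivFin ⟨y, hy⟩ : ℕ)
    rw [hF] at this
    simpa [L] using this
  refine ⟨⟨fun x => toSphere (F x) (hF0 x), continuous_toSphere s.card (fun x i hi => ?_)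
    (fun i => ?_) _, fun x y hxy => ?_⟩⟩
  · simp only [hF, L, dif_neg (not_lt.2 hi.le), _root_.zero_apply]
  · simp only [hF]
    fun_prop
  · have : F y = -F x := by
      ext i
      simp only [hF, hxy, map_neg, Finsupp.neg_apply]
    change (toSphere (F y) _).1 = _
    rw [toSphere_congr this _ (neg_ne_zero.2 (hF0 x))]
    simp [toSphere, sqNorm_neg]

theorem ind_eq_top {E : Type*} [AddCommGroup E] [TopologicalSpace E] {A : Set E}
    (h : (0 : E) ∈ A) : ind A = ⊤ := if_pos h

/-- If a compact symmetric set of index at least `p + 1` is covered by closed symmetric sets and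
`∑ pᵢ ≤ p`, then some odd continuous image of one of them has index at least `pᵢ + 1`. -/
theorem exists_le_ind_image {E : Type*} [NormedAddCommGroup E] {A : Set E} (hA : IsCompact A)
    (hAs : ∀ u ∈ A, -u ∈ A) (h0 : (0 : E) ∉ A) {p : ℕ} (hp : ((p + 1 : ℕ) : ℕ∞) ≤ ind A)
    {ι : Type*} [Fintype ι] {F : ι → Type*} [∀ i, NormedAddCommGroup (F i)]
    [∀ i, NormedSpace ℝ (F i)] {R : ∀ i, E → F i} (hR : ∀ i, Continuous (R i))
    (hRn : ∀ i u, R i (-u) = -R i u) {C : ι → Set E} (hC : ∀ i, IsClosed (C i))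
    (hCA : ∀ i, C i ⊆ A) (hCs : ∀ i, ∀ u ∈ C i, -u ∈ C i) (hcover : A ⊆ ⋃ i, C i) {q : ι → ℕ}
    (hq : ∑ i, q i ≤ p) : ∃ i, ((q i + 1 : ℕ) : ℕ∞) ≤ ind (R i '' C i) := by
  by_contra! hcon
  have hCc : ∀ i, IsCompact (C i) := fun i => hA.of_isClosed_subset (hC i) (hCA i)
  -- A supremum of at least p + 1 yields a nonzero power of some exponent m ≥ p, not necessarily p
  -- itself.
  obtain ⟨m, hpm, ω, hω, hωn, f, hf⟩ : ∃ m, p ≤ m ∧ ∃ ω : Cochain RPInf 1, IsCocycle ω ∧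
      ¬ IsCoboundary ω ∧
      ∃ f : OddMap A, ¬ IsCoboundary (PhaseTransition.pullback f.descend (cupPow ω m)) := by
    by_contra hno
    rw [ind, if_neg h0] at hp
    have : sSup {k : ℕ∞ | ∃ m : ℕ, k = ((m + 1 : ℕ) : ℕ∞) ∧
        ∃ ω : Cochain RPInf 1, IsCocycle ω ∧ ¬ IsCoboundary ω ∧
          ∃ f : OddMap A, ¬ IsCoboundary (PhaseTransition.pullback f.descend (cupPow ω m))} ≤
        (p : ℕ∞) := by
      refine sSup_le ?_
      rintro _ ⟨m, rfl, hm⟩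
      rw [Nat.cast_le]
      by_contra hlt
      exact hno ⟨m, by omega, hm⟩
    have h2 := hp.trans this
    rw [Nat.cast_le] at h2
    omega
  obtain ⟨h, hh1, hh2⟩ := exists_odd_primitive hω hωn
  have hθ := f.isOddPrimitive hh1 hh2
  have hv : ∀ i ∈ Finset.univ, PowVanishes
      (fun X Y => PhaseTransition.pullback f.descend ω ![X, Y])
      (orbit '' {x : A | (x : E) ∈ C i}) (q i) := by
    intro i _
    -- An image containing the origin would have infinite index. Without the origin an odd map
    -- exists, so that the small index really forces a power to vanish.
    have h0i : (0 : F i) ∉ R i '' C i := by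
      intro h
      have := hcon i
      rw [ind_eq_top h] at this
      exact not_top_lt this
    obtain ⟨g⟩ := nonempty_oddMap ((hCc i).image (hR i)) h0i
    refine PowVanishes.of_image hAs (hCc i) (hCs i) (hR i) (hRn i) hθ
      (g.isOddPrimitive hh1 hh2) ?_
    rw [powVanishes_univ_iff, ← pullback_cupPow]
    by_contra hg
    refine absurd (hcon i) (not_lt.2 ?_)
    rw [ind, if_neg h0i]
    exact le_sSup ⟨q i, rfl, ω, hω, hωn, g, hg⟩
  have hun : ⋃ i ∈ Finset.univ, orbit '' {x : A | (x : E) ∈ C i} = Set.univ := by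
    refine Set.eq_univ_of_forall fun X => ?_
    obtain ⟨x, rfl⟩ : ∃ x : A, orbit x = X := Quotient.exists_rep X
    obtain ⟨i, hi⟩ := Set.mem_iUnion.1 (hcover x.2)
    exact Set.mem_iUnion₂.2 ⟨i, Finset.mem_univ i, x, hi, rfl⟩
  have htot := (PowVanishes.iUnion (hθ.cocycleNear hAs _) hv).of_le (hθ.cocycleNear hAs _)
    (hq.trans hpm)
  rw [hun, powVanishes_univ_iff, ← pullback_cupPow] at htot
  exact hf htot

/-! ### Composition operators on Lebesgue spaces -/

section CompLp

variable {α β F : Type*} [MeasurableSpace α] [MeasurableSpace β] [NormedAddCommGroup F]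
  {μ : Measure α} {ν : Measure β} {Φ : α → β} {C : ℝ≥0∞}

theorem quasiMeasurePreserving_of_map_le (hΦ : Measurable Φ) (h : μ.map Φ ≤ C • ν) :
    Measure.QuasiMeasurePreserving Φ μ ν :=
  ⟨hΦ, (Measure.absolutelyContinuous_of_le h).trans Measure.smul_absolutelyContinuous⟩

theorem memLp_comp_of_map_le (hΦ : Measurable Φ) (hC : C ≠ ⊤) (h : μ.map Φ ≤ C • ν) {f : β → F}
    (hf : MemLp f 2 ν) : MemLp (f ∘ Φ) 2 μ :=
  (hf.of_measure_le_smul hC h).comp_of_map hΦ.aemeasurable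

variable [NormedSpace ℝ F]

/-- Composition with a map `Φ` such that `Φ_* μ ≤ C ν`, as an operator `L²(ν) → L²(μ)`. -/
def compLp (hΦ : Measurable Φ) (hC : C ≠ ⊤) (h : μ.map Φ ≤ C • ν) : Lp F 2 ν →L[ℝ] Lp F 2 μ :=
  LinearMap.mkContinuous
    { toFun := fun f => (memLp_comp_of_map_le hΦ hC h (Lp.memLp f)).toLp
      map_add' := fun f g => by
        rw [← MemLp.toLp_add]
        exact MemLp.toLp_congr _ _
          ((quasiMeasurePreserving_of_map_le hΦ h).ae_eq_comp (Lp.coeFn_add f g))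
      map_smul' := fun c f => by
        rw [RingHom.id_apply, ← MemLp.toLp_const_smul]
        exact MemLp.toLp_congr _ _
          ((quasiMeasurePreserving_of_map_le hΦ h).ae_eq_comp (Lp.coeFn_smul c f)) }
    -- The norm of f ∘ Φ in L²(μ) is that of f in L² of the image measure, hence at most C^(1/2)
    -- times its norm in L²(ν).
    (C ^ (1 / (2 : ℝ≥0∞)).toReal).toReal (fun f => by
      change ‖(memLp_comp_of_map_le hΦ hC h (Lp.memLp f)).toLp‖ ≤ _
      rw [Lp.norm_toLp, Lp.norm_def, ← ENNReal.toReal_mul]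
      refine ENNReal.toReal_mono (ENNReal.mul_ne_top
        (ENNReal.rpow_ne_top_of_nonneg ENNReal.toReal_nonneg hC) (Lp.eLpNorm_ne_top f)) ?_
      rw [← smul_eq_mul, ← eLpNorm_smul_measure_of_ne_top (by simp),
        ← eLpNorm_map_measure _ hΦ.aemeasurable]
      · exact eLpNorm_mono_measure _ h
      · exact ((Lp.memLp f).of_measure_le_smul hC h).aestronglyMeasurable)

theorem coeFn_compLp (hΦ : Measurable Φ) (hC : C ≠ ⊤) (h : μ.map Φ ≤ C • ν) (f : Lp F 2 ν) :
    (compLp hΦ hC h f : α → F) =ᵐ[μ] fun x => f (Φ x) :=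
  MemLp.coeFn_toLp (memLp_comp_of_map_le hΦ hC h (Lp.memLp f))

end CompLp

/-! ### Similarities -/

section Similarity

variable {n : ℕ}

/-- The similarity `x ↦ r A x + b`. -/
def similarity (r : ℝ) (hr : r ≠ 0) (A : Euc n ≃ₗᵢ[ℝ] Euc n) (b : Euc n) : Euc n ≃ₜ Euc n :=
  (Homeomorph.smulOfNeZero r hr).trans (A.toHomeomorph.trans (Homeomorph.addRight b))

theorem similarity_apply (r : ℝ) (hr : r ≠ 0) (A : Euc n ≃ₗᵢ[ℝ] Euc n) (b x : Euc n) :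
    similarity r hr A b x = A (r • x) + b := rfl

/-- By the Mazur-Ulam theorem an isometry of a real normed space onto itself is affine; b is the
image of the origin. -/
theorem AreSimilar.exists_similarity {Ω₁ Ω₂ : Set (Euc n)} (h : AreSimilar Ω₁ Ω₂) :
    ∃ (r : ℝ) (hr : 0 < r) (A : Euc n ≃ₗᵢ[ℝ] Euc n) (b : Euc n),
      Ω₂ = similarity r hr.ne' A b '' Ω₁ := by
  obtain ⟨r, hr, e, rfl⟩ := h
  refine ⟨r, hr, e.toRealLinearIsometryEquiv, e 0, ?_⟩
  congr 1
  funext x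
  rw [similarity_apply, IsometryEquiv.toRealLinearIsometryEquiv_apply, sub_add_cancel]

variable {r : ℝ} (hr : 0 < r) (A : Euc n ≃ₗᵢ[ℝ] Euc n) (b : Euc n)

theorem map_similarity :
    (volume : Measure (Euc n)).map (similarity r hr.ne' A b) =
      ENNReal.ofReal ((r ^ (n + 1))⁻¹) • volume := by
  have h1 := Measure.map_addHaar_smul (volume : Measure (Euc n)) hr.ne'
  have h2 : (volume : Measure (Euc n)).map (fun x => A x + b) = volume :=
    ((measurePreserving_add_right volume b).comp A.measurePreserving).map_eq
  have hm : Measurable fun x : Euc n => A x + b := by fun_prop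
  have e : (similarity r hr.ne' A b : Euc n → Euc n) = (fun x => A x + b) ∘ fun x => r • x := rfl
  rw [e, ← Measure.map_map hm (by fun_prop), h1, Measure.map_smul, h2, finrank_euclideanSpace_fin,
    abs_of_pos (by positivity)]

theorem map_restrict_similarity (Ω₁ : Set (Euc n)) :
    (volume.restrict Ω₁).map (similarity r hr.ne' A b) =
      ENNReal.ofReal ((r ^ (n + 1))⁻¹) • volume.restrict (similarity r hr.ne' A b '' Ω₁) := by
  have h := (similarity r hr.ne' A b).measurableEmbedding.restrict_map volume
    (similarity r hr.ne' A b '' Ω₁)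
  rw [(similarity r hr.ne' A b).injective.preimage_image, map_similarity hr,
    Measure.restrict_smul] at h
  exact h.symm

theorem map_restrict_similarity_le {Ω Ω₁ : Set (Euc n)}
    (hsub : similarity r hr.ne' A b '' Ω₁ ⊆ Ω) :
    (volume.restrict Ω₁).map (similarity r hr.ne' A b) ≤
      ENNReal.ofReal ((r ^ (n + 1))⁻¹) • volume.restrict Ω := by
  rw [map_restrict_similarity hr]
  gcongr

theorem volume_image_similarity (Ω₁ : Set (Euc n)) :
    volume (similarity r hr.ne' A b '' Ω₁) = ENNReal.ofReal (r ^ (n + 1)) * volume Ω₁ := by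
  have h := congrArg (fun μ : Measure (Euc n) => μ (similarity r hr.ne' A b '' Ω₁))
    (map_similarity hr A b)
  beta_reduce at h
  rw [(similarity r hr.ne' A b).measurableEmbedding.map_apply,
    (similarity r hr.ne' A b).injective.preimage_image] at h
  rw [h, Measure.smul_apply, smul_eq_mul, ← mul_assoc, ← ENNReal.ofReal_mul (by positivity),
    mul_inv_cancel₀ (by positivity), ENNReal.ofReal_one, one_mul]

theorem lintegral_comp_similarity (Ω₁ : Set (Euc n)) (f : Euc n → ℝ≥0∞) :
    ∫⁻ x in Ω₁, f (similarity r hr.ne' A b x) =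
      ENNReal.ofReal ((r ^ (n + 1))⁻¹) * ∫⁻ y in similarity r hr.ne' A b '' Ω₁, f y := by
  rw [← (similarity r hr.ne' A b).measurableEmbedding.lintegral_map, map_restrict_similarity hr,
    lintegral_smul_measure, smul_eq_mul]

theorem integral_comp_similarity (Ω₁ : Set (Euc n)) (f : Euc n → ℝ) :
    ∫ x in Ω₁, f (similarity r hr.ne' A b x) =
      (r ^ (n + 1))⁻¹ * ∫ y in similarity r hr.ne' A b '' Ω₁, f y := by
  rw [← (similarity r hr.ne' A b).measurableEmbedding.integral_map, map_restrict_similarity hr,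
    integral_smul_measure, smul_eq_mul, ENNReal.toReal_ofReal (by positivity)]

theorem hasFDerivAt_similarity (x : Euc n) :
    HasFDerivAt (similarity r hr.ne' A b)
      (r • (A : Euc n →L[ℝ] Euc n)) x := by
  have h : (similarity r hr.ne' A b : Euc n → Euc n) =
      fun x => (r • (A : Euc n →L[ℝ] Euc n)) x + b := by
    funext x
    rw [similarity_apply, map_smul]
    rfl
  rw [h]
  exact (ContinuousLinearMap.hasFDerivAt _).add_const b

theorem contDiff_similarity_symm {k : WithTop ℕ∞} :
    ContDiff ℝ k (similarity r hr.ne' A b).symm := by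
  have h : ((similarity r hr.ne' A b).symm : Euc n → Euc n) =
      fun y => r⁻¹ • A.symm (y - b) := by
    funext y
    rw [Homeomorph.symm_apply_eq, similarity_apply, smul_inv_smul₀ hr.ne',
      LinearIsometryEquiv.apply_symm_apply, sub_add_cancel]
  rw [h]
  exact (A.symm.contDiff.comp (contDiff_id.sub contDiff_const)).const_smul r⁻¹

/-- Test functions are transported by similarities. -/
theorem IsTest.comp_similarity_symm {Ω₁ : Set (Euc n)} {φ : Euc n → ℝ} (hφ : IsTest Ω₁ φ) :
    IsTest (similarity r hr.ne' A b '' Ω₁) (φ ∘ (similarity r hr.ne' A b).symm) := by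
  refine ⟨hφ.1.comp (contDiff_similarity_symm hr A b),
    hφ.2.1.comp_homeomorph (similarity r hr.ne' A b).symm, ?_⟩
  rw [tsupport_comp_eq_preimage]
  intro y hy
  exact ⟨_, hφ.2.2 hy, (similarity r hr.ne' A b).apply_symm_apply y⟩

theorem IsTest.mono {Ω₁ Ω : Set (Euc n)} {φ : Euc n → ℝ} (hφ : IsTest Ω₁ φ) (h : Ω₁ ⊆ Ω) :
    IsTest Ω φ := ⟨hφ.1, hφ.2.1, hφ.2.2.trans h⟩

theorem IsTest.setIntegral_mul_fderiv {Ω₁ Ω : Set (Euc n)} (hΩ : MeasurableSet Ω)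
    {φ : Euc n → ℝ} (hφ : IsTest Ω₁ φ) (h : Ω₁ ⊆ Ω) (u : Euc n → ℝ) (v : Euc n) :
    ∫ x in Ω, u x * fderiv ℝ φ x v = ∫ x in Ω₁, u x * fderiv ℝ φ x v := by
  refine setIntegral_eq_of_subset_of_forall_sdiff_eq_zero hΩ h fun x hx => ?_
  have : fderiv ℝ φ x = 0 := by
    by_contra hne
    exact hx.2 (hφ.2.2 (support_fderiv_subset ℝ (Function.mem_support.2 hne)))
  rw [this]
  simp

theorem IsTest.setIntegral_mul {Ω₁ Ω : Set (Euc n)} (hΩ : MeasurableSet Ω)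
    {φ : Euc n → ℝ} (hφ : IsTest Ω₁ φ) (h : Ω₁ ⊆ Ω) (u : Euc n → ℝ) :
    ∫ x in Ω, u x * φ x = ∫ x in Ω₁, u x * φ x := by
  refine setIntegral_eq_of_subset_of_forall_sdiff_eq_zero hΩ h fun x hx => ?_
  have : φ x = 0 := by
    by_contra hne
    exact hx.2 (hφ.2.2 (subset_tsupport φ (Function.mem_support.2 hne)))
  rw [this, mul_zero]

/-- Chain rule for weak gradients under similarities. -/
theorem IsWeakGradient.comp_similarity {Ω Ω₁ : Set (Euc n)} (hΩ : MeasurableSet Ω)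
    (hsub : similarity r hr.ne' A b '' Ω₁ ⊆ Ω) {u : Euc n → ℝ} {g : Euc n → Euc n}
    (h : IsWeakGradient Ω u g) :
    IsWeakGradient Ω₁ (fun x => u (similarity r hr.ne' A b x))
      fun x => r • A.symm (g (similarity r hr.ne' A b x)) := by
  intro φ hφ v
  have hψ := hφ.comp_similarity_symm hr A b
  set S := similarity r hr.ne' A b with hS
  set ψ : Euc n → ℝ := φ ∘ S.symm with hψd
  have hφψ : φ = ψ ∘ S := by
    funext x
    simp [hψd]
  have hd : ∀ x, fderiv ℝ φ x v = fderiv ℝ ψ (S x) (r • A v) := by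
    intro x
    have h1 : HasFDerivAt ψ (fderiv ℝ ψ (S x)) (S x) :=
      ((hψ.1.differentiable (by simp)) (S x)).hasFDerivAt
    have h2 := (h1.comp x (hasFDerivAt_similarity hr A b x)).fderiv
    rw [hφψ]
    rw [h2]
    rfl
  have key := h ψ (hψ.mono hsub) (r • A v)
  rw [hψ.setIntegral_mul_fderiv hΩ hsub, hψ.setIntegral_mul hΩ hsub] at key
  calc ∫ x in Ω₁, u (S x) * fderiv ℝ φ x v
      = ∫ x in Ω₁, (fun y => u y * fderiv ℝ ψ y (r • A v)) (S x) := by simp only [hd]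
    _ = (r ^ (n + 1))⁻¹ * ∫ y in S '' Ω₁, u y * fderiv ℝ ψ y (r • A v) :=
        integral_comp_similarity hr A b Ω₁ (fun y => u y * fderiv ℝ ψ y (r • A v))
    _ = -((r ^ (n + 1))⁻¹ * ∫ y in S '' Ω₁, inner ℝ (g y) (r • A v) * ψ y) := by
        rw [key]
        ring
    _ = -∫ x in Ω₁, (fun y => inner ℝ (g y) (r • A v) * ψ y) (S x) := by
        rw [integral_comp_similarity hr A b Ω₁ (fun y => inner ℝ (g y) (r • A v) * ψ y)]
    _ = -∫ x in Ω₁, inner ℝ (r • A.symm (g (S x))) v * φ x := by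
        congr 2
        funext x
        have : inner ℝ (A.symm (g (S x))) v = inner ℝ (g (S x)) (A v) := by
          rw [← A.inner_map_map, A.apply_symm_apply]
        simp only [hφψ, Function.comp, inner_smul_left, inner_smul_right, this]
        simp

theorem IsWeakGradient.congr {Ω : Set (Euc n)} {u u' : Euc n → ℝ} {g g' : Euc n → Euc n}
    (h : IsWeakGradient Ω u g) (hu : u' =ᵐ[volume.restrict Ω] u)
    (hg : g' =ᵐ[volume.restrict Ω] g) : IsWeakGradient Ω u' g' := by
  intro φ hφ v
  rw [integral_congr_ae (g := fun x => u x * fderiv ℝ φ x v)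
      (by filter_upwards [hu] with x hx; rw [hx]),
    integral_congr_ae (f := fun x => inner ℝ (g' x) v * φ x) (g := fun x => inner ℝ (g x) v * φ x)
      (by filter_upwards [hg] with x hx; rw [hx])]
  exact h φ hφ v

/-- The operator `(u, g) ↦ (u ∘ S, r A⁻¹ (g ∘ S))` on pairs of square integrable functions. -/
def similarityLp {Ω Ω₁ : Set (Euc n)} (hsub : similarity r hr.ne' A b '' Ω₁ ⊆ Ω) :
    (Lp ℝ 2 (volume.restrict Ω) × Lp (Euc n) 2 (volume.restrict Ω)) →L[ℝ]
      Lp ℝ 2 (volume.restrict Ω₁) × Lp (Euc n) 2 (volume.restrict Ω₁) :=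
  (compLp (similarity r hr.ne' A b).continuous.measurable ENNReal.ofReal_ne_top
    (map_restrict_similarity_le hr A b hsub)).prodMap
  ((ContinuousLinearMap.compLpL 2 (volume.restrict Ω₁)
      (r • (A.symm : Euc n →L[ℝ] Euc n))).comp
    (compLp (similarity r hr.ne' A b).continuous.measurable ENNReal.ofReal_ne_top
      (map_restrict_similarity_le hr A b hsub)))

theorem coeFn_similarityLp_fst {Ω Ω₁ : Set (Euc n)} (hsub : similarity r hr.ne' A b '' Ω₁ ⊆ Ω)
    (w : Lp ℝ 2 (volume.restrict Ω) × Lp (Euc n) 2 (volume.restrict Ω)) :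
    ((similarityLp hr A b hsub w).1 : Euc n → ℝ) =ᵐ[volume.restrict Ω₁]
      fun x => w.1 (similarity r hr.ne' A b x) :=
  coeFn_compLp (similarity r hr.ne' A b).continuous.measurable ENNReal.ofReal_ne_top
    (map_restrict_similarity_le hr A b hsub) w.1

theorem coeFn_similarityLp_snd {Ω Ω₁ : Set (Euc n)} (hsub : similarity r hr.ne' A b '' Ω₁ ⊆ Ω)
    (w : Lp ℝ 2 (volume.restrict Ω) × Lp (Euc n) 2 (volume.restrict Ω)) :
    ((similarityLp hr A b hsub w).2 : Euc n → Euc n) =ᵐ[volume.restrict Ω₁]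
      fun x => r • A.symm (w.2 (similarity r hr.ne' A b x)) := by
  have h1 := coeFn_compLp (similarity r hr.ne' A b).continuous.measurable ENNReal.ofReal_ne_top
    (map_restrict_similarity_le hr A b hsub) w.2
  have h2 := ContinuousLinearMap.coeFn_compLpL (p := 2) (μ := volume.restrict Ω₁)
    (r • (A.symm : Euc n →L[ℝ] Euc n))
    (compLp (similarity r hr.ne' A b).continuous.measurable ENNReal.ofReal_ne_top
      (map_restrict_similarity_le hr A b hsub) w.2)
  filter_upwards [h1, h2] with x hx1 hx2
  refine hx2.trans ?_
  rw [hx1]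
  rfl

/-- Restriction to a similar subdomain, as an operator between Sobolev spaces. -/
def similarityH1 {Ω Ω₁ : Set (Euc n)} (hΩ : MeasurableSet Ω)
    (hsub : similarity r hr.ne' A b '' Ω₁ ⊆ Ω) : H1 Ω →L[ℝ] H1 Ω₁ :=
  ((similarityLp hr A b hsub).comp (H1 Ω).subtypeL).codRestrict (H1 Ω₁) fun u =>
    IsWeakGradient.congr (IsWeakGradient.comp_similarity hr A b hΩ hsub u.2)
      (coeFn_similarityLp_fst hr A b hsub u.1) (coeFn_similarityLp_snd hr A b hsub u.1)

theorem coe_similarityH1 {Ω Ω₁ : Set (Euc n)} (hΩ : MeasurableSet Ω)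
    (hsub : similarity r hr.ne' A b '' Ω₁ ⊆ Ω) (u : H1 Ω) :
    (similarityH1 hr A b hΩ hsub u).1 = similarityLp hr A b hsub u.1 :=
  ContinuousLinearMap.coe_codRestrict_apply _ _ _ _

/-- With ε/r in place of ε, the gradient term gains r² / r and the potential term gains r, so both
scale alike. Together with the Jacobian r^(-(n+1)) this produces the factor r^n in the energy. -/
theorem energy_integrand_scaling {r : ℝ} (hr : 0 < r) (A : Euc n ≃ₗᵢ[ℝ] Euc n)
    (W : ℝ → ℝ) (ε s : ℝ) (y : Euc n) :
    ENNReal.ofReal (ε / r * ‖r • A.symm y‖ ^ 2 / 2 + W s / (ε / r)) =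
      ENNReal.ofReal r * ENNReal.ofReal (ε * ‖y‖ ^ 2 / 2 + W s / ε) := by
  rw [norm_smul, A.symm.norm_map, Real.norm_of_nonneg hr.le, ← ENNReal.ofReal_mul hr.le]
  congr 1
  rw [div_div_eq_mul_div]
  field_simp

theorem lintegral_energy_comp_similarity (W : ℝ → ℝ) (ε : ℝ) (Ω₁ : Set (Euc n))
    (u : Euc n → ℝ) (g : Euc n → Euc n) {u' : Euc n → ℝ} {g' : Euc n → Euc n}
    (hu : u' =ᵐ[volume.restrict Ω₁] fun x => u (similarity r hr.ne' A b x))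
    (hg : g' =ᵐ[volume.restrict Ω₁] fun x => r • A.symm (g (similarity r hr.ne' A b x))) :
    ENNReal.ofReal (r ^ n) *
        ∫⁻ x in Ω₁, ENNReal.ofReal (ε / r * ‖g' x‖ ^ 2 / 2 + W (u' x) / (ε / r)) =
      ∫⁻ x in similarity r hr.ne' A b '' Ω₁,
        ENNReal.ofReal (ε * ‖g x‖ ^ 2 / 2 + W (u x) / ε) := by
  have h : ∫⁻ x in Ω₁, ENNReal.ofReal (ε / r * ‖g' x‖ ^ 2 / 2 + W (u' x) / (ε / r)) =
      ∫⁻ x in Ω₁, (fun y => ENNReal.ofReal r *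
        ENNReal.ofReal (ε * ‖g y‖ ^ 2 / 2 + W (u y) / ε)) (similarity r hr.ne' A b x) := by
    refine lintegral_congr_ae ?_
    filter_upwards [hu, hg] with x hx1 hx2
    rw [hx1, hx2, energy_integrand_scaling hr]
  have e : r ^ n * (r ^ (n + 1))⁻¹ * r = 1 := by
    field_simp
    ring
  rw [h, lintegral_comp_similarity hr A b Ω₁ (fun y => ENNReal.ofReal r *
      ENNReal.ofReal (ε * ‖g y‖ ^ 2 / 2 + W (u y) / ε)),
    lintegral_const_mul' _ _ ENNReal.ofReal_ne_top,
    ← mul_assoc, ← mul_assoc, ← ENNReal.ofReal_mul (by positivity),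
    ← ENNReal.ofReal_mul (by positivity), e, ENNReal.ofReal_one, one_mul]

/-- Scaling of the energy under similarities. -/
theorem energy_similarityH1 (W : ℝ → ℝ) (ε : ℝ) {Ω Ω₁ : Set (Euc n)} (hΩ : MeasurableSet Ω)
    (hsub : similarity r hr.ne' A b '' Ω₁ ⊆ Ω) (u : H1 Ω) :
    ENNReal.ofReal (r ^ n) * energy W (ε / r) Ω₁ (similarityH1 hr A b hΩ hsub u) =
      ∫⁻ x in similarity r hr.ne' A b '' Ω₁,
        ENNReal.ofReal (ε * ‖u.1.2 x‖ ^ 2 / 2 + W (u.1.1 x) / ε) := by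
  rw [energy, coe_similarityH1]
  exact lintegral_energy_comp_similarity hr A b W ε Ω₁ u.1.1 u.1.2
    (coeFn_similarityLp_fst hr A b hsub u.1) (coeFn_similarityLp_snd hr A b hsub u.1)

end Similarity

/-! ### The energy -/

section Energy

variable {n : ℕ} {W : ℝ → ℝ} {Ω : Set (Euc n)}

theorem energy_neg (hW : ∀ t, W (-t) = W t) (ε : ℝ) (u : H1 Ω) :
    energy W ε Ω (-u) = energy W ε Ω u := by
  refine lintegral_congr_ae ?_
  filter_upwards [Lp.coeFn_neg u.1.1, Lp.coeFn_neg u.1.2] with x h1 h2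
  have e1 : (-u).1.1 x = -u.1.1 x := h1
  have e2 : (-u).1.2 x = -u.1.2 x := h2
  rw [e1, e2, norm_neg, hW]

/-- The energy is lower semicontinuous. -/
theorem isClosed_energy_le (hW : Continuous W) (ε : ℝ) (c : ℝ≥0∞) :
    IsClosed {u : H1 Ω | energy W ε Ω u ≤ c} := by
  refine IsSeqClosed.isClosed fun u v hu huv => ?_
  have hfst : Tendsto (fun k => (u k).1.1) atTop (𝓝 v.1.1) :=
    ((continuous_fst.comp continuous_subtype_val).tendsto v).comp huv
  have hsnd : Tendsto (fun k => (u k).1.2) atTop (𝓝 v.1.2) :=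
    ((continuous_snd.comp continuous_subtype_val).tendsto v).comp huv
  -- Functions and then gradients converge almost everywhere along successive subsequences, and
  -- Fatou's lemma applies.
  obtain ⟨a, ha, h1⟩ := (tendstoInMeasure_of_tendsto_Lp hfst).exists_seq_tendsto_ae
  obtain ⟨b, hb, h2⟩ :=
    (tendstoInMeasure_of_tendsto_Lp (hsnd.comp ha.tendsto_atTop)).exists_seq_tendsto_ae
  let f : ℕ → Euc n → ℝ≥0∞ := fun k x =>
    ENNReal.ofReal (ε * ‖(u (a (b k))).1.2 x‖ ^ 2 / 2 + W ((u (a (b k))).1.1 x) / ε)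
  have hf : ∀ k, AEMeasurable (f k) (volume.restrict Ω) := by
    intro k
    have m1 : Measurable ((u (a (b k))).1.1) := (Lp.stronglyMeasurable _).measurable
    have m2 : Measurable ((u (a (b k))).1.2) := (Lp.stronglyMeasurable _).measurable
    have m3 := hW.measurable
    exact (((((m2.norm.pow_const 2).const_mul ε).div_const 2).add
      ((m3.comp m1).div_const ε)).ennreal_ofReal).aemeasurable
  change energy W ε Ω v ≤ c
  calc energy W ε Ω v = ∫⁻ x in Ω, liminf (fun k => f k x) atTop := by
        refine lintegral_congr_ae ?_
        filter_upwards [h1, h2] with x hx1 hx2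
        have hx1' := hx1.comp hb.tendsto_atTop
        refine Tendsto.liminf_eq ?_ |>.symm
        refine ENNReal.tendsto_ofReal ?_
        exact ((((hx2.norm.pow 2).const_mul ε).div_const 2).add
          (((hW.tendsto _).comp hx1').div_const ε))
    _ ≤ liminf (fun k => ∫⁻ x in Ω, f k x) atTop := lintegral_liminf_le' hf
    _ ≤ c := by
        refine liminf_le_of_le (by isBoundedDefault) fun d hd => ?_
        obtain ⟨k, hk⟩ := hd.exists
        exact hk.trans (hu _)

end Energy

/-! ### The min-max values -/

/-- A finite weighted sum is bounded if all strictly smaller sums are. -/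
theorem sum_mul_le_of_forall_lt {ι : Type*} [Fintype ι] {a c : ι → ℝ≥0∞} (ha : ∀ i, a i ≠ ⊤)
    {s : ℝ≥0∞}
    (h : ∀ b : ι → ℝ≥0∞, (∀ i, c i ≠ 0 → b i < c i) → (∀ i, c i = 0 → b i = 0) →
      ∑ i, a i * b i ≤ s) : ∑ i, a i * c i ≤ s := by
  have hseq : ∀ i, ∃ b : ℕ → ℝ≥0∞, Tendsto b atTop (𝓝 (c i)) ∧ (c i ≠ 0 → ∀ k, b k < c i) ∧
      (c i = 0 → ∀ k, b k = 0) := by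
    intro i
    by_cases hc : c i = 0
    · exact ⟨fun _ => 0, hc ▸ tendsto_const_nhds, fun h => absurd hc h, fun _ _ => rfl⟩
    · obtain ⟨b, -, h1, h2⟩ := exists_seq_strictMono_tendsto' (pos_iff_ne_zero.2 hc)
      exact ⟨b, h2, fun _ k => (h1 k).2, fun h => absurd h hc⟩
  choose b hb1 hb2 hb3 using hseq
  have hlim : Tendsto (fun k => ∑ i, a i * b i k) atTop (𝓝 (∑ i, a i * c i)) :=
    tendsto_finsetSum _ fun i _ => ENNReal.Tendsto.const_mul (hb1 i) (Or.inr (ha i))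
  exact le_of_tendsto' hlim fun k => h _ (fun i hi => hb2 i hi k) fun i hi => hb3 i hi k

/-- Simultaneous Lusternik-Schnirelman argument: if every compact symmetric set of index at least
`qᵢ + 1` contains a point with `eᵢ > dᵢ`, then a compact symmetric set of index at least
`1 + ∑ qᵢ` contains a point whose images satisfy all these inequalities. -/
theorem exists_forall_lt_of_le_ind {E : Type*} [NormedAddCommGroup E] [NormedSpace ℝ E] {A : Set E}
    (hA : IsCompact A) (hAs : ∀ u ∈ A, -u ∈ A) (h0 : (0 : E) ∉ A) {p : ℕ}
    (hp : ((p + 1 : ℕ) : ℕ∞) ≤ ind A) {ι : Type*} [Fintype ι] {F : ι → Type*}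
    [∀ i, NormedAddCommGroup (F i)] [∀ i, NormedSpace ℝ (F i)] (R : ∀ i, E →L[ℝ] F i) {q : ι → ℕ}
    (hq : ∑ i, q i ≤ p) {P : ι → Prop} {e : ∀ i, F i → ℝ≥0∞} {d : ι → ℝ≥0∞}
    (hcl : ∀ i, IsClosed {u | e i u ≤ d i}) (hneg : ∀ i u, e i (-u) = e i u)
    (he : ∀ i, P i → ∀ D : Set (F i), IsCompact D → (∀ u ∈ D, -u ∈ D) →
      ((q i + 1 : ℕ) : ℕ∞) ≤ ind D → ∃ u ∈ D, d i < e i u) :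
    ∃ u ∈ A, ∀ i, P i → d i < e i (R i u) := by
  classical
  by_contra! hcon
  have hclosed : ∀ i, IsClosed (A ∩ R i ⁻¹' {u | e i u ≤ d i}) := fun i =>
    hA.isClosed.inter ((hcl i).preimage (R i).continuous)
  have hsymm : ∀ i, ∀ u ∈ A ∩ R i ⁻¹' {u | e i u ≤ d i},
      -u ∈ A ∩ R i ⁻¹' {u | e i u ≤ d i} := by
    rintro i u ⟨hu, hu'⟩
    refine ⟨hAs u hu, ?_⟩
    rw [Set.mem_preimage, map_neg]
    exact (hneg i (R i u)).trans_le hu'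
  -- Indices failing P impose no condition on the point and are dropped from the cover, which only
  -- lowers the sum of the q i.
  have hq' : ∑ i : {i // P i}, q i ≤ p := by
    refine le_trans ?_ hq
    rw [← Finset.sum_subtype (Finset.univ.filter P) (by simp) q]
    exact Finset.sum_le_sum_of_subset (Finset.filter_subset _ _)
  obtain ⟨⟨i, hi⟩, hind⟩ := exists_le_ind_image hA hAs h0 hp (ι := {i // P i})
    (F := fun i => F i) (R := fun i => R i) (fun i => (R i).continuous)
    (fun i u => map_neg (R i) u) (C := fun i => A ∩ R i ⁻¹' {u | e i u ≤ d i})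
    (fun i => hclosed i) (fun i => Set.inter_subset_left) (fun i => hsymm i) (fun u hu => by
      obtain ⟨i, hPi, hi⟩ := hcon u hu
      exact Set.mem_iUnion.2 ⟨⟨i, hPi⟩, hu, hi⟩) hq'
  obtain ⟨_, ⟨u, hu, rfl⟩, hlt⟩ := he i hi _
    ((hA.of_isClosed_subset (hclosed i) Set.inter_subset_left).image (R i).continuous) (by
      rintro _ ⟨u, hu, rfl⟩
      exact ⟨-u, hsymm i u hu, map_neg (R i) u⟩) hind
  exact absurd hu.2 (not_le.2 hlt)

/-! ### Superadditivity of the min-max values, lower limits and rounding. -/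

section MinMax

variable {n : ℕ} {W : ℝ → ℝ}

/-- The singleton of the origin has infinite index, so it competes for every p. -/
theorem minmax_le_energy_zero (ε : ℝ) (p : ℕ) (Ω : Set (Euc n)) :
    minmax W ε p Ω ≤ energy W ε Ω 0 := by
  have h : ({0} : Set (H1 Ω)) ∈ sweepouts p Ω := by
    refine ⟨isCompact_singleton, fun u hu => ?_, ?_⟩
    · rw [Set.mem_singleton_iff] at hu ⊢
      rw [hu, neg_zero]
    · rw [ind_eq_top (Set.mem_singleton 0)]
      exact le_top
  refine (iInf₂_le _ h).trans ?_
  simp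

/-- Lusternik-Schnirelman inequality for the min-max values at a fixed scale. -/
theorem sum_minmax_le (hW : IsDoubleWell W) (ε : ℝ) {N : ℕ} {Ω : Set (Euc n)}
    {Ωi : Fin N → Set (Euc n)} (hΩ : MeasurableSet Ω) (hΩi : ∀ i, MeasurableSet (Ωi i))
    {r : Fin N → ℝ} (hr : ∀ i, 0 < r i) (A : Fin N → Euc n ≃ₗᵢ[ℝ] Euc n) (b : Fin N → Euc n)
    (hsub : ∀ i, similarity (r i) (hr i).ne' (A i) (b i) '' Ωi i ⊆ Ω)
    (hdisj : Pairwise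
      (Function.onFun Disjoint fun i => similarity (r i) (hr i).ne' (A i) (b i) '' Ωi i))
    {p : ℕ} {q : Fin N → ℕ} (hq : ∑ i, q i ≤ p) :
    ∑ i, ENNReal.ofReal (r i ^ n) * minmax W (ε / r i) (q i) (Ωi i) ≤ minmax W ε p Ω := by
  let R : ∀ i, H1 Ω →L[ℝ] H1 (Ωi i) := fun i => similarityH1 (hr i) (A i) (b i) hΩ (hsub i)
  have hsum : ∀ u : H1 Ω,
      ∑ i, ENNReal.ofReal (r i ^ n) * energy W (ε / r i) (Ωi i) (R i u) ≤ energy W ε Ω u := by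
    intro u
    have hm : ∀ i, MeasurableSet (similarity (r i) (hr i).ne' (A i) (b i) '' Ωi i) := fun i =>
      (similarity (r i) (hr i).ne' (A i) (b i)).measurableEmbedding.measurableSet_image.2 (hΩi i)
    simp only [R, energy_similarityH1]
    rw [← tsum_fintype (L := .unconditional _), ← lintegral_iUnion hm hdisj]
    exact lintegral_mono_set (Set.iUnion_subset hsub)
  refine le_iInf₂ fun B hB => ?_
  obtain ⟨hBc, hBs, hBi⟩ := hB
  -- If B contains the origin, the zero function, whose restrictions are all zero, serves as the
  -- test point; the cup length argument is needed only in the other case.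
  by_cases h0 : (0 : H1 Ω) ∈ B
  · refine le_trans ?_ ((hsum 0).trans (le_iSup₂ (f := fun u (_ : u ∈ B) => energy W ε Ω u) 0 h0))
    gcongr with i
    rw [map_zero]
    exact minmax_le_energy_zero _ _ _
  refine sum_mul_le_of_forall_lt (fun i => ENNReal.ofReal_ne_top) fun d hd1 hd0 => ?_
  obtain ⟨u, hu, hdu⟩ := exists_forall_lt_of_le_ind hBc hBs h0 hBi R hq
    (P := fun i => minmax W (ε / r i) (q i) (Ωi i) ≠ 0)
    (e := fun i => energy W (ε / r i) (Ωi i)) (d := d)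
    (fun i => isClosed_energy_le hW.contDiff.continuous _ _) (fun i => energy_neg hW.even _)
    (fun i hi D hD hDs hDi => by
      have h1 := (hd1 i hi).trans_le (iInf₂_le D ⟨hD, hDs, hDi⟩)
      simpa only [lt_iSup_iff, exists_prop] using h1)
  refine le_trans ?_ ((hsum u).trans (le_iSup₂ (f := fun u (_ : u ∈ B) => energy W ε Ω u) u hu))
  gcongr with i
  by_cases hi : minmax W (ε / r i) (q i) (Ωi i) = 0
  · rw [hd0 i hi]
    exact zero_le
  · exact (hdu i hi).le

theorem tendsto_div_nhdsGT_zero {r : ℝ} (hr : 0 < r) :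
    Tendsto (fun ε : ℝ => ε / r) (𝓝[>] 0) (𝓝[>] 0) := by
  refine tendsto_nhdsWithin_iff.2 ⟨?_, ?_⟩
  · have : Tendsto (fun ε : ℝ => ε / r) (𝓝 0) (𝓝 (0 / r)) := tendsto_id.div_const r
    rw [zero_div] at this
    exact this.mono_left nhdsWithin_le_nhds
  · filter_upwards [self_mem_nhdsWithin] with ε hε
    exact div_pos hε hr

/-- Passage to the lower limit in a superadditive inequality. -/
theorem sum_mul_liminf_le {N : ℕ} {f : ℝ → ℝ≥0∞} {g : Fin N → ℝ → ℝ≥0∞} {r : Fin N → ℝ}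
    (hr : ∀ i, 0 < r i) {a : Fin N → ℝ≥0∞} (ha : ∀ i, a i ≠ ⊤)
    (h : ∀ ε, ∑ i, a i * g i (ε / r i) ≤ f ε) :
    ∑ i, a i * liminf (g i) (𝓝[>] 0) ≤ liminf f (𝓝[>] 0) := by
  refine sum_mul_le_of_forall_lt ha fun b hb1 hb0 => ?_
  have hev : ∀ i, ∀ᶠ ε in 𝓝[>] (0 : ℝ), b i ≤ g i (ε / r i) := by
    intro i
    by_cases hc : liminf (g i) (𝓝[>] 0) = 0
    · rw [hb0 i hc]
      exact Eventually.of_forall fun _ => zero_le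
    · filter_upwards [(tendsto_div_nhdsGT_zero (hr i)).eventually
        (eventually_lt_of_lt_liminf (hb1 i hc))] with ε hε
      exact hε.le
  refine le_liminf_of_le (by isBoundedDefault) ?_
  filter_upwards [eventually_all.2 hev] with ε hε
  refine le_trans ?_ (h ε)
  gcongr with i
  exact hε i

theorem weight_mul_limsup_le_gammaConst {p : ℕ} (hp : 1 ≤ p) (Ω : Set (Euc n)) :
    weight n p * limsup (fun ε : ℝ => minmax W ε p Ω) (𝓝[>] 0) ≤ gammaConst W Ω :=
  le_sInf fun _ hγ => hγ.2 p hp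

theorem weight_zero (n : ℕ) : weight n 0 = 0 := by
  have : -(1 : ℝ) / ((n : ℝ) + 1) ≠ 0 := div_ne_zero (by norm_num) (by positivity)
  simp [weight, Real.zero_rpow this]

/-- The comparison of `q ^ (-1 / (n + 1))` with `(p v) ^ (-1 / (n + 1))` for `q = ⌊p v⌋`, where
`v = r ^ (n + 1)`. -/
theorem rpow_floor_le (n : ℕ) {p q : ℕ} (hp : 1 ≤ p) (hq : 1 ≤ q) {r : ℝ} (hr : 0 < r)
    (h1 : (q : ℝ) ≤ p * r ^ (n + 1)) (h2 : p * r ^ (n + 1) < (q : ℝ) + 1) :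
    r ^ (n + 1) * (q : ℝ) ^ (-(1 : ℝ) / ((n : ℝ) + 1)) ≤
      (p : ℝ) ^ (-(1 : ℝ) / ((n : ℝ) + 1)) * r ^ n +
        (q : ℝ) ^ (-(1 : ℝ) / ((n : ℝ) + 1)) * (1 / p) := by
  have hp' : (0 : ℝ) < p := by exact_mod_cast hp
  have hq' : (0 : ℝ) < q := by exact_mod_cast hq
  set e : ℝ := -(1 : ℝ) / ((n : ℝ) + 1) with he
  have he1 : 0 ≤ 1 + e := by
    have : 1 + e = n / ((n : ℝ) + 1) := by
      rw [he]
      field_simp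
      ring
    rw [this]
    positivity
  set s : ℝ := p * r ^ (n + 1) with hs
  have hs0 : 0 < s := by positivity
  -- Since (r^(n+1))^e = 1/r, the two weights match exactly when q = s = p r^(n+1); only the
  -- rounding from s to q remains.
  have hrs : (p : ℝ) ^ e * r ^ n * p = s ^ (1 + e) := by
    have h3 : (r ^ (n + 1)) ^ e = r⁻¹ := by
      have : e = -((n + 1 : ℕ) : ℝ)⁻¹ := by
        rw [he]
        push_cast
        ring
      rw [this, Real.rpow_neg (by positivity), Real.pow_rpow_inv_natCast hr.le (by omega)]
    rw [Real.rpow_add hs0, Real.rpow_one]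
    nth_rewrite 2 [hs]
    rw [Real.mul_rpow hp'.le (by positivity), h3, hs]
    field_simp
    ring
  have hqs : (q : ℝ) * (q : ℝ) ^ e ≤ s ^ (1 + e) := by
    have : (q : ℝ) * (q : ℝ) ^ e = (q : ℝ) ^ (1 + e) := by
      rw [Real.rpow_add hq', Real.rpow_one]
    rw [this]
    exact Real.rpow_le_rpow hq'.le h1 he1
  have hqe : 0 < (q : ℝ) ^ e := Real.rpow_pos_of_pos hq' e
  -- Uses s - 1 < q together with q^(1+e) ≤ s^(1+e), valid since 1 + e ≥ 0.
  have h4 : (s - 1) * (q : ℝ) ^ e ≤ (p : ℝ) ^ e * r ^ n * p := by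
    rw [hrs]
    refine le_trans ?_ hqs
    gcongr
    linarith
  have h5 : r ^ (n + 1) = s / p := by
    rw [hs]
    field_simp
  rw [h5, ← sub_nonneg]
  have h6 : (p : ℝ) ^ e * r ^ n + (q : ℝ) ^ e * (1 / p) - s / p * (q : ℝ) ^ e =
      ((p : ℝ) ^ e * r ^ n * p - (s - 1) * (q : ℝ) ^ e) / p := by
    field_simp
    ring
  rw [h6]
  exact div_nonneg (by linarith) hp'.le

/-- The estimate of a single term of the Lusternik-Schnirelman inequality. -/
theorem volume_mul_weight_mul_le {p q : ℕ} (hp : 1 ≤ p) {r : ℝ} (hr : 0 < r)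
    (hq : q = ⌊(p : ℝ) * r ^ (n + 1)⌋₊) {L γ V : ℝ≥0∞} (hL : 1 ≤ q → weight n q * L ≤ γ)
    (hV : V ≤ ENNReal.ofReal (r ^ (n + 1))) :
    ENNReal.ofReal (r ^ (n + 1)) * (weight n q * L) ≤
      weight n p * (ENNReal.ofReal (r ^ n) * L) +
        ENNReal.ofReal (r ^ (n + 1)) * (γ / (p * V)) := by
  rcases Nat.eq_zero_or_pos q with h0 | hq1
  · rw [h0, weight_zero]
    simp
  have hp' : (0 : ℝ) < p := by exact_mod_cast hp
  have hv : 0 < r ^ (n + 1) := by positivity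
  have h1 : (q : ℝ) ≤ p * r ^ (n + 1) := hq ▸ Nat.floor_le (by positivity)
  have h2 : p * r ^ (n + 1) < (q : ℝ) + 1 := hq ▸ Nat.lt_floor_add_one _
  have h3 := ENNReal.ofReal_le_ofReal (rpow_floor_le n hp hq1 hr h1 h2)
  rw [ENNReal.ofReal_add (by positivity) (by positivity), ENNReal.ofReal_mul hv.le,
    ENNReal.ofReal_mul (by positivity), ENNReal.ofReal_mul (by positivity)] at h3
  have h4 : ENNReal.ofReal (r ^ (n + 1)) * weight n q ≤
      weight n p * ENNReal.ofReal (r ^ n) + weight n q * (p : ℝ≥0∞)⁻¹ := by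
    rw [one_div, ENNReal.ofReal_inv_of_pos hp', ENNReal.ofReal_natCast] at h3
    exact h3
  -- The rounding error γ/p is rewritten as a multiple of the volume r^(n+1) ≥ V, so that the errors
  -- can later be summed against the volumes.
  have h5 : γ * (p : ℝ≥0∞)⁻¹ ≤ ENNReal.ofReal (r ^ (n + 1)) * (γ / (p * V)) := by
    have hne : ENNReal.ofReal (r ^ (n + 1)) ≠ 0 := (ENNReal.ofReal_pos.2 hv).ne'
    have hp0 : (p : ℝ≥0∞) ≠ 0 := by
      rw [Nat.cast_ne_zero]
      omega
    calc γ * (p : ℝ≥0∞)⁻¹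
        = ENNReal.ofReal (r ^ (n + 1)) * (γ / (p * ENNReal.ofReal (r ^ (n + 1)))) := by
          rw [div_eq_mul_inv, ENNReal.mul_inv (Or.inl hp0) (Or.inl (ENNReal.natCast_ne_top p))]
          calc γ * (p : ℝ≥0∞)⁻¹ = γ * (p : ℝ≥0∞)⁻¹ *
                (ENNReal.ofReal (r ^ (n + 1)) * (ENNReal.ofReal (r ^ (n + 1)))⁻¹) := by
                rw [ENNReal.mul_inv_cancel hne ENNReal.ofReal_ne_top, mul_one]
            _ = _ := by ring
      _ ≤ _ := by gcongr
  calc ENNReal.ofReal (r ^ (n + 1)) * (weight n q * L)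
      = ENNReal.ofReal (r ^ (n + 1)) * weight n q * L := by ring
    _ ≤ (weight n p * ENNReal.ofReal (r ^ n) + weight n q * (p : ℝ≥0∞)⁻¹) * L := by gcongr
    _ = weight n p * (ENNReal.ofReal (r ^ n) * L) + weight n q * L * (p : ℝ≥0∞)⁻¹ := by ring
    _ ≤ weight n p * (ENNReal.ofReal (r ^ n) * L) + γ * (p : ℝ≥0∞)⁻¹ := by
        gcongr
        exact hL hq1
    _ ≤ _ := by gcongr

end MinMax

end PhaseTransition

end

/-! ### Assembly of the inequality. -/

theorem mainTheorem12 (W : ℝ → ℝ) (hW : PhaseTransition.IsDoubleWell W) (n N : ℕ) (hN : 1 ≤ N)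
    (Ω : Set (PhaseTransition.Euc n)) (Ωi Ωs : Fin N → Set (PhaseTransition.Euc n))
    (hΩ : IsOpen Ω) (hΩi : ∀ i, IsOpen (Ωi i))
    (hvol : volume Ω = 1) (hvoli : ∀ i, volume (Ωi i) = 1)
    (hsim : ∀ i, PhaseTransition.AreSimilar (Ωi i) (Ωs i))
    (hsub : ∀ i, Ωs i ⊆ Ω)
    (hdisj : ∀ i j, i ≠ j → Disjoint (Ωs i) (Ωs j))
    (p : ℕ) (hp : 1 ≤ p) (pi : Fin N → ℕ)
    (hpi : ∀ i, pi i = ⌊(p : ℝ) * (volume (Ωs i)).toReal⌋₊)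
    (V c : ℝ≥0∞) (hV : V = ⨅ i, volume (Ωs i))
    (hc : c = (⨆ i, PhaseTransition.gammaConst W (Ωi i)) /
      ENNReal.ofReal (2 * PhaseTransition.sigma W)) :
    ∑ i, volume (Ωs i) *
        (PhaseTransition.weight n (pi i) * PhaseTransition.spectrum W (pi i) (Ωi i))
      ≤ PhaseTransition.weight n p * PhaseTransition.spectrum W p Ω + c / ((p : ℝ≥0∞) * V) := by
  choose r hr A b hS using fun i => (hsim i).exists_similarity
  have hvs : ∀ i, volume (Ωs i) = ENNReal.ofReal (r i ^ (n + 1)) := by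
    intro i
    rw [hS i, PhaseTransition.volume_image_similarity (hr i), hvoli, mul_one]
  have hvr : ∀ i, (volume (Ωs i)).toReal = r i ^ (n + 1) := fun i => by
    rw [hvs, ENNReal.toReal_ofReal (pow_pos (hr i) _).le]
  have hm : ∀ i, MeasurableSet (Ωs i) := fun i => by
    rw [hS i]
    exact ((PhaseTransition.similarity (r i) (hr i).ne' (A i) (b i)).isOpenMap _
      (hΩi i)).measurableSet
  have hd : Pairwise (Function.onFun Disjoint Ωs) := fun i j hij => hdisj i j hij
  have hvsum : ∑ i, volume (Ωs i) ≤ 1 := by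
    rw [← tsum_fintype (L := .unconditional _), ← measure_iUnion hd hm, ← hvol]
    exact measure_mono (Set.iUnion_subset hsub)
  -- Rounding down and total volume at most 1 provide the index budget for the cup length argument.
  have hq : ∑ i, pi i ≤ p := by
    have h1 : ∑ i, (volume (Ωs i)).toReal ≤ 1 := by
      rw [← ENNReal.toReal_sum fun i _ => by rw [hvs]; exact ENNReal.ofReal_ne_top]
      exact ENNReal.toReal_mono ENNReal.one_ne_top hvsum
    have h2 : ((∑ i, pi i : ℕ) : ℝ) ≤ p := by
      push_cast
      calc ∑ i, (pi i : ℝ) ≤ ∑ i, (p : ℝ) * (volume (Ωs i)).toReal := by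
            gcongr with i
            rw [hpi]
            exact Nat.floor_le (by positivity)
        _ = p * ∑ i, (volume (Ωs i)).toReal := (Finset.mul_sum _ _ _).symm
        _ ≤ p * 1 := by gcongr
        _ = p := mul_one _
    exact_mod_cast h2
  have hLS : ∑ i, ENNReal.ofReal (r i ^ n) *
      liminf (fun ε : ℝ => PhaseTransition.minmax W ε (pi i) (Ωi i)) (𝓝[>] 0) ≤
        liminf (fun ε : ℝ => PhaseTransition.minmax W ε p Ω) (𝓝[>] 0) := by
    refine PhaseTransition.sum_mul_liminf_le (r := r) hr (fun i => ENNReal.ofReal_ne_top)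
      fun ε => ?_
    refine PhaseTransition.sum_minmax_le hW ε hΩ.measurableSet (fun i => (hΩi i).measurableSet) hr
      A b (fun i => hS i ▸ hsub i) ?_ hq
    have he : (fun i => PhaseTransition.similarity (r i) (hr i).ne' (A i) (b i) '' Ωi i) = Ωs :=
      funext fun i => (hS i).symm
    rw [he]
    exact hd
  set γ : ℝ≥0∞ := ⨆ i, PhaseTransition.gammaConst W (Ωi i) with hγ
  set κ : ℝ≥0∞ := (ENNReal.ofReal (2 * PhaseTransition.sigma W))⁻¹ with hκ
  have hterm : ∀ i, volume (Ωs i) * (PhaseTransition.weight n (pi i) *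
      liminf (fun ε : ℝ => PhaseTransition.minmax W ε (pi i) (Ωi i)) (𝓝[>] 0)) ≤
      PhaseTransition.weight n p * (ENNReal.ofReal (r i ^ n) *
        liminf (fun ε : ℝ => PhaseTransition.minmax W ε (pi i) (Ωi i)) (𝓝[>] 0)) +
        volume (Ωs i) * (γ / (p * V)) := by
    intro i
    rw [hvs]
    refine PhaseTransition.volume_mul_weight_mul_le hp (hr i) (by rw [hpi, hvr]) (fun h => ?_)
      (by rw [hV, ← hvs]; exact iInf_le _ i)
    refine le_trans ?_ ((PhaseTransition.weight_mul_limsup_le_gammaConst h (Ωi i)).trans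
      (le_iSup (fun i => PhaseTransition.gammaConst W (Ωi i)) i))
    gcongr
    -- The spectrum uses lower limits, while γ bounds upper limits.
    exact liminf_le_limsup
  calc ∑ i, volume (Ωs i) *
        (PhaseTransition.weight n (pi i) * PhaseTransition.spectrum W (pi i) (Ωi i))
      = (∑ i, volume (Ωs i) * (PhaseTransition.weight n (pi i) *
          liminf (fun ε : ℝ => PhaseTransition.minmax W ε (pi i) (Ωi i)) (𝓝[>] 0))) * κ := by
        rw [Finset.sum_mul]
        refine Finset.sum_congr rfl fun i _ => ?_
        rw [PhaseTransition.spectrum, div_eq_mul_inv, ← hκ]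
        ring
    _ ≤ (∑ i, (PhaseTransition.weight n p * (ENNReal.ofReal (r i ^ n) *
        liminf (fun ε : ℝ => PhaseTransition.minmax W ε (pi i) (Ωi i)) (𝓝[>] 0)) +
        volume (Ωs i) * (γ / (p * V)))) * κ := by
        gcongr with i
        exact hterm i
    _ = (PhaseTransition.weight n p * (∑ i, ENNReal.ofReal (r i ^ n) *
        liminf (fun ε : ℝ => PhaseTransition.minmax W ε (pi i) (Ωi i)) (𝓝[>] 0)) +
        (∑ i, volume (Ωs i)) * (γ / (p * V))) * κ := by
        rw [Finset.sum_add_distrib, Finset.mul_sum, Finset.sum_mul]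
    -- The volumes sum to at most 1, so a single error term remains, independent of N.
    _ ≤ (PhaseTransition.weight n p *
        liminf (fun ε : ℝ => PhaseTransition.minmax W ε p Ω) (𝓝[>] 0) +
        1 * (γ / (p * V))) * κ := by
        gcongr
    _ = PhaseTransition.weight n p * PhaseTransition.spectrum W p Ω + c / ((p : ℝ≥0∞) * V) := by
        rw [PhaseTransition.spectrum, hc, div_eq_mul_inv, div_eq_mul_inv, div_eq_mul_inv,
          div_eq_mul_inv, ← hκ]
        ring
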